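/- A symmetric network $G$ is a finite directed graph (parallel edges allowed) with two distinct designated nodes, a source $s$ and a sink $t$, such that every node and every edge lies on some simple directed $s$-$t$ path. A symmetric capacitated cost-sharing (CCS) game on $G$ is given by a number $n$ of agents, a cost $p_e\ge 0$ (a real number) and a capacity $c_e\in\mathbb{N}\cup\{0\}$ for each edge $e$. The strategies of every agent are the simple directed $s$-$t$ paths. For a strategy profile $\sigma=(\sigma_1,\dots,\sigma_n)$ let $x_e(\sigma)=|\{i : e\in \sigma_i\}|$; the profile is feasible if $x_e(\sigma)\le c_e$ for every $e$, and the game is feasible if it has a feasible profile. The cost of agent $i$ is $p_i(\sigma)=\sum_{e\in \sigma_i} p_e/x_e(\sigma)$ if $\sigma$ is feasible, and $\infty$ otherwise. A profile $\sigma$ is a strong equilibrium (SE) if for every nonempty coalition $C$ of agents and all strategies $\sigma'_C$ of its members there is an agent $j\in C$ with $p_j(\sigma)\le p_j(\sigma'_C,\sigma_{-C})$. The network $G$ admits a SE if every feasible symmetric CCS game on $G$ (for every choice of costs, capacities and number of agents) has a SE. The series composition of two networks identifies the sink of the first with the source of the second; the parallel composition identifies the two sources and identifies the two sinks. A network is Series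 of Parallel Paths (SPP) if, up to isomorphism, it is a series composition $G_1\to\cdots\to G_k$ ($k\ge 1$) of networks $G_i$, each of which is a parallel composition of one or more simple directed source-sink paths with at least one edge. Theorem. A symmetric network $G$ admits a SE if and only if $G$ is an SPP network. -/

import Mathlib

open scoped NNReal ENNReal

universe u v u' v'

/-- A symmetric network: a directed multigraph with vertex type `V` and edge type `E`
(edge `e` goes from `tail e` to `head e`), a source and a sink. -/
structure Network (V : Type u) (E : Type v) where
  tail : E → V
  head : E → V
  source : V
  sink : V

namespace Network

variable {V : Type u} {E : Type v}

/-- The edge list `l` is a directed walk from `a` to `b`. -/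
def IsWalk (N : Network V E) : V → List E → V → Prop
  | a, [], b => a = b
  | a, e :: l, b => N.tail e = a ∧ N.IsWalk (N.head e) l b

/-- The list of vertices visited by a walk with edge list `l` that starts at the source. -/
def visited (N : Network V E) (l : List E) : List V :=
  N.source :: l.map N.head

/-- The edge list `l` is a (simple, directed) path from the source to the sink. -/
def IsSTPath (N : Network V E) (l : List E) : Prop :=
  N.IsWalk N.source l N.sink ∧ (N.visited l).Nodup

/-- An isomorphism of symmetric networks. -/
structure Iso {V' : Type u'} {E' : Type v'} (N : Network V E) (N' : Network V' E') where
  vertexEquiv : V ≃ V'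
  edgeEquiv : E ≃ E'
  map_tail : ∀ e, vertexEquiv (N.tail e) = N'.tail (edgeEquiv e)
  map_head : ∀ e, vertexEquiv (N.head e) = N'.head (edgeEquiv e)
  map_source : vertexEquiv N.source = N'.source
  map_sink : vertexEquiv N.sink = N'.sink

/-- The simple path with `k + 1` edges, directed from its source to its sink. -/
def simplePath (k : ℕ) : Network (Fin (k + 2)) (Fin (k + 1)) where
  tail := Fin.castSucc
  head := Fin.succ
  source := 0
  sink := Fin.last (k + 1)

section Composition

variable {V₁ V₂ : Type u} {E₁ E₂ : Type v}

/-- The only identification of a series composition: the sink of the first network with the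
source of the second. -/
inductive SeriesGlue (N₁ : Network V₁ E₁) (N₂ : Network V₂ E₂) : V₁ ⊕ V₂ → V₁ ⊕ V₂ → Prop
  | glue : SeriesGlue N₁ N₂ (Sum.inl N₁.sink) (Sum.inr N₂.source)

/-- Series composition: the disjoint union of the two networks with the sink of the first
identified with the source of the second. -/
def series (N₁ : Network V₁ E₁) (N₂ : Network V₂ E₂) :
    Network (Quot (SeriesGlue N₁ N₂)) (E₁ ⊕ E₂) where
  tail := Sum.elim (fun e => Quot.mk _ (Sum.inl (N₁.tail e)))
    (fun e => Quot.mk _ (Sum.inr (N₂.tail e)))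
  head := Sum.elim (fun e => Quot.mk _ (Sum.inl (N₁.head e)))
    (fun e => Quot.mk _ (Sum.inr (N₂.head e)))
  source := Quot.mk _ (Sum.inl N₁.source)
  sink := Quot.mk _ (Sum.inr N₂.sink)

/-- The identifications of a parallel composition: source with source and sink with sink. -/
inductive ParallelGlue (N₁ : Network V₁ E₁) (N₂ : Network V₂ E₂) : V₁ ⊕ V₂ → V₁ ⊕ V₂ → Prop
  | source : ParallelGlue N₁ N₂ (Sum.inl N₁.source) (Sum.inr N₂.source)
  | sink : ParallelGlue N₁ N₂ (Sum.inl N₁.sink) (Sum.inr N₂.sink)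

/-- Parallel composition: the disjoint union of the two networks with the two sources
identified and the two sinks identified. -/
def parallel (N₁ : Network V₁ E₁) (N₂ : Network V₂ E₂) :
    Network (Quot (ParallelGlue N₁ N₂)) (E₁ ⊕ E₂) where
  tail := Sum.elim (fun e => Quot.mk _ (Sum.inl (N₁.tail e)))
    (fun e => Quot.mk _ (Sum.inr (N₂.tail e)))
  head := Sum.elim (fun e => Quot.mk _ (Sum.inl (N₁.head e)))
    (fun e => Quot.mk _ (Sum.inr (N₂.head e)))
  source := Quot.mk _ (Sum.inl N₁.source)
  sink := Quot.mk _ (Sum.inl N₁.sink)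

end Composition

/-- `N` is (isomorphic to) a parallel composition of one or more simple paths. -/
inductive IsParallelPaths : {V : Type u} → {E : Type v} → Network V E → Prop
  | path {V : Type u} {E : Type v} {N : Network V E} (k : ℕ) (iso : N.Iso (simplePath k)) :
      IsParallelPaths N
  | parallel {V V₁ V₂ : Type u} {E E₁ E₂ : Type v} {N : Network V E}
      {N₁ : Network V₁ E₁} {N₂ : Network V₂ E₂}
      (h₁ : IsParallelPaths N₁) (h₂ : IsParallelPaths N₂) (iso : N.Iso (N₁.parallel N₂)) :
      IsParallelPaths N

/-- `N` is (isomorphic to) a series composition of one or more networks, each of which is a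
parallel composition of simple paths: a *series of parallel paths* (SPP). -/
inductive IsSPP : {V : Type u} → {E : Type v} → Network V E → Prop
  | block {V : Type u} {E : Type v} {N : Network V E} (h : IsParallelPaths N) : IsSPP N
  | series {V V₁ V₂ : Type u} {E E₁ E₂ : Type v} {N : Network V E}
      {N₁ : Network V₁ E₁} {N₂ : Network V₂ E₂}
      (h₁ : IsSPP N₁) (h₂ : IsParallelPaths N₂) (iso : N.Iso (N₁.series N₂)) : IsSPP N

/-- The strategy space of every agent: the paths from the source to the sink. -/
def Strategy (N : Network V E) : Type v := {l : List E // N.IsSTPath l}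

/-- A symmetric capacitated cost-sharing game on `N`: the number of agents, the edge costs and
the edge capacities. -/
structure CCSGame (_N : Network V E) where
  agents : ℕ
  cost : E → ℝ≥0
  capacity : E → ℕ

namespace CCSGame

variable {N : Network V E}

/-- A strategy profile. -/
abbrev Profile (Δ : CCSGame N) : Type v := Fin Δ.agents → N.Strategy

open Classical in
/-- The number of agents that use the edge `e` in the profile `σ`. -/
noncomputable def load (Δ : CCSGame N) (σ : Δ.Profile) (e : E) : ℕ :=
  (Finset.univ.filter fun i => e ∈ (σ i).1).card

/-- A profile is feasible if it respects all the capacities. -/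
def IsFeasible (Δ : CCSGame N) (σ : Δ.Profile) : Prop :=
  ∀ e, Δ.load σ e ≤ Δ.capacity e

/-- A game is feasible if it has a feasible profile. -/
def Feasible (Δ : CCSGame N) : Prop :=
  ∃ σ : Δ.Profile, Δ.IsFeasible σ

open Classical in
/-- The cost of agent `i` in the profile `σ`: the fair shares of the edges on her path if `σ` is
feasible, and `∞` otherwise. (The edge list of a path has no repetition.) -/
noncomputable def agentCost (Δ : CCSGame N) (σ : Δ.Profile) (i : Fin Δ.agents) : ℝ≥0∞ :=
  if Δ.IsFeasible σ then
    ((((σ i).1.map fun e => Δ.cost e / (Δ.load σ e : ℝ≥0)).sum : ℝ≥0) : ℝ≥0∞)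
  else ⊤

/-- `σ` is a strong equilibrium: for every nonempty coalition `C` and every joint deviation of
`C` (a profile `τ` in which the agents outside `C` play as in `σ`), some member of `C` does not
strictly decrease her cost. -/
def IsStrongEquilibrium (Δ : CCSGame N) (σ : Δ.Profile) : Prop :=
  ∀ C : Finset (Fin Δ.agents), C.Nonempty → ∀ τ : Δ.Profile, (∀ i, i ∉ C → τ i = σ i) →
    ∃ j ∈ C, Δ.agentCost σ j ≤ Δ.agentCost τ j

end CCSGame

/-- `N` admits a strong equilibrium: every feasible game played on `N` has one. -/
def AdmitsSE (N : Network V E) : Prop :=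
  ∀ Δ : CCSGame N, Δ.Feasible → ∃ σ : Δ.Profile, Δ.IsStrongEquilibrium σ

end Network

/-! Necessity. Suppose a vertex with two outgoing edges is avoided by some source-sink path. Then
the network contains a path with two ears that leave it at different vertices `p`, `u` (with `p`
strictly before `u`) and never return to its part up to `u`. In this subnetwork every source-sink
path contains, among four marked edges, exactly `a, b`, or exactly `a, c`, or exactly `d`
(`isObstruction_of_ears`, `exists_isObstruction_of_two_out`). Suitable costs and capacities on these
edges give a feasible two-agent game without strong equilibria (`IsObstruction.not_admitsSE`).
Reversing all edges treats two incoming edges. So a network that admits a SE is thin: a vertex that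
does not lie on all paths has at most one incoming and one outgoing edge. Cutting a thin network at
its last internal cut vertex leaves a smaller thin network, followed by a network without internal
cut vertices. In the latter internal vertices have unique edges, which makes it a bundle of parallel
paths (`isParallelPaths_of_unique_edges`, `IsThin.isSPP`).

Sufficiency. The invariant is `IsOrdered`: some feasible profile leaves agent `j` no way to pay less
while agents `0, ..., j - 1` stay put, whatever the later ones do. It yields a SE, because the least
member of a coalition cannot gain. On parallel paths, which share no edges, it is obtained by
repeatedly filling the path with the lowest attainable share (`exists_greedy_assignment`). It passes
to series compositions, because shares add up over the blocks and the same order of agents serves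
all of them (`IsOrdered.of_concat`). -/

namespace Network

/-! ### Walks, simple walks and crossings of cuts. -/

section Walk

variable {V : Type u} {E : Type v} {N : Network V E}

/-- The vertices visited by a walk with edge list `l` that starts at `a`. -/
def verts (N : Network V E) (a : V) (l : List E) : List V := a :: l.map N.head

theorem visited_eq (l : List E) : N.visited l = N.verts N.source l := rfl

theorem verts_append (a : V) (l₁ l₂ : List E) :
    N.verts a (l₁ ++ l₂) = N.verts a l₁ ++ l₂.map N.head := by
  simp [verts]

theorem verts_cons (a : V) (e : E) (l : List E) :
    N.verts a (e :: l) = a :: N.verts (N.head e) l := by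
  simp [verts]

theorem start_mem_verts (a : V) (l : List E) : a ∈ N.verts a l := by simp [verts]

theorem head_mem_verts {a : V} {l : List E} {e : E} (he : e ∈ l) : N.head e ∈ N.verts a l :=
  List.mem_cons_of_mem _ (List.mem_map_of_mem he)

theorem isWalk_append {a b : V} {l₁ l₂ : List E} :
    N.IsWalk a (l₁ ++ l₂) b ↔ ∃ c, N.IsWalk a l₁ c ∧ N.IsWalk c l₂ b := by
  induction l₁ generalizing a with
  | nil => simp [IsWalk]
  | cons e l ih => simp [IsWalk, ih, and_assoc]

theorem IsWalk.append {a b c : V} {l₁ l₂ : List E} (h₁ : N.IsWalk a l₁ c)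
    (h₂ : N.IsWalk c l₂ b) : N.IsWalk a (l₁ ++ l₂) b :=
  isWalk_append.2 ⟨c, h₁, h₂⟩

theorem IsWalk.end_unique {a b c : V} {l : List E} (h₁ : N.IsWalk a l b)
    (h₂ : N.IsWalk a l c) : b = c := by
  induction l generalizing a with
  | nil => exact h₁.symm.trans h₂
  | cons e l ih => exact ih h₁.2 h₂.2

theorem IsWalk.end_mem_verts {a b : V} {l : List E} (h : N.IsWalk a l b) :
    b ∈ N.verts a l := by
  induction l generalizing a with
  | nil => simp [verts, show a = b from h]
  | cons e l ih => rw [verts_cons]; exact List.mem_cons_of_mem _ (ih h.2)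

theorem IsWalk.end_mem_heads {a b : V} {l : List E} (h : N.IsWalk a l b) (hl : l ≠ []) :
    ∃ e ∈ l, N.head e = b := by
  cases l with
  | nil => exact absurd rfl hl
  | cons e l =>
    have := h.2.end_mem_verts
    simp only [verts, List.mem_cons, List.mem_map] at this
    rcases this with rfl | ⟨f, hf, rfl⟩
    · exact ⟨e, by simp, rfl⟩
    · exact ⟨f, by simp [hf], rfl⟩

theorem IsWalk.tail_mem_verts {a b : V} {l : List E} (h : N.IsWalk a l b) {e : E}
    (he : e ∈ l) : N.tail e ∈ N.verts a l := by
  induction l generalizing a with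
  | nil => simp at he
  | cons f l ih =>
    rw [verts_cons]
    rcases List.mem_cons.1 he with rfl | he
    · simp [h.1]
    · exact List.mem_cons_of_mem _ (ih h.2 he)

theorem IsWalk.split {a b x : V} {l : List E} (h : N.IsWalk a l b) (hx : x ∈ N.verts a l) :
    ∃ l₁ l₂, l = l₁ ++ l₂ ∧ N.IsWalk a l₁ x ∧ N.IsWalk x l₂ b := by
  induction l generalizing a with
  | nil =>
    have : x = a := by simpa [verts] using hx
    subst this
    exact ⟨[], [], rfl, rfl, h⟩
  | cons e l ih =>
    by_cases hxa : x = a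
    · subst hxa
      exact ⟨[], e :: l, rfl, rfl, h⟩
    · rw [verts_cons, List.mem_cons] at hx
      obtain ⟨l₁, l₂, rfl, h₁, h₂⟩ := ih h.2 (hx.resolve_left hxa)
      exact ⟨e :: l₁, l₂, rfl, ⟨h.1, h₁⟩, h₂⟩

theorem nodup_of_nodup_verts {a : V} {l : List E} (h : (N.verts a l).Nodup) : l.Nodup :=
  List.Nodup.of_map _ (List.nodup_cons.1 h).2

theorem IsWalk.nodup_right {a b : V} {l₁ l₂ : List E} (h₁ : N.IsWalk a l₁ b)
    (h : (N.verts a (l₁ ++ l₂)).Nodup) : (N.verts b l₂).Nodup := by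
  induction l₁ generalizing a with
  | nil =>
    have : a = b := h₁
    subst this
    exact h
  | cons e l ih =>
    rw [List.cons_append, verts_cons] at h
    exact ih h₁.2 (List.nodup_cons.1 h).2

theorem nodup_left {a : V} {l₁ l₂ : List E}
    (h : (N.verts a (l₁ ++ l₂)).Nodup) : (N.verts a l₁).Nodup := by
  rw [verts_append] at h
  exact (List.nodup_append.1 h).1

theorem head_notMem_of_nodup {a : V} {l₁ l₂ : List E} (h : (N.verts a (l₁ ++ l₂)).Nodup)
    {e : E} (he : e ∈ l₂) : N.head e ∉ N.verts a l₁ := by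
  rw [verts_append] at h
  exact fun h' => (List.nodup_append.1 h).2.2 _ h' _ (List.mem_map_of_mem he) rfl

/-- Every walk contains a simple walk. -/
theorem IsWalk.exists_simple {a b : V} {l : List E} (h : N.IsWalk a l b) :
    ∃ l', l' ⊆ l ∧ N.IsWalk a l' b ∧ (N.verts a l').Nodup := by
  induction l generalizing a with
  | nil => exact ⟨[], by simp, h, by simp [verts]⟩
  | cons e l ih =>
    obtain ⟨l', hl, hw, hn⟩ := ih h.2
    by_cases ha : a ∈ N.verts (N.head e) l'
    · obtain ⟨l₁, l₂, rfl, h₁, h₂⟩ := hw.split ha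
      refine ⟨l₂, fun x hx => List.mem_cons_of_mem _ (hl (by simp [hx])), h₂, ?_⟩
      exact h₁.nodup_right hn
    · refine ⟨e :: l', ?_, ⟨h.1, hw⟩, ?_⟩
      · exact List.cons_subset_cons _ hl
      · rw [verts_cons]
        exact List.nodup_cons.2 ⟨ha, hn⟩

/-- A walk that visits a set and ends outside it has a last exit from it. -/
theorem IsWalk.last_exit {a b : V} {l : List E} (h : N.IsWalk a l b) (X : Set V)
    (ha : ∃ x ∈ N.verts a l, x ∈ X) (hb : b ∉ X) :
    ∃ l₁ e l₂, l = l₁ ++ e :: l₂ ∧ N.IsWalk a l₁ (N.tail e) ∧ N.tail e ∈ X ∧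
      N.IsWalk (N.head e) l₂ b ∧ ∀ f ∈ e :: l₂, N.head f ∉ X := by
  induction l generalizing a with
  | nil =>
    obtain ⟨x, hx, hxX⟩ := ha
    have : x = a := by simpa [verts] using hx
    exact absurd ((this.trans (show a = b from h)) ▸ hxX) hb
  | cons e l ih =>
    by_cases hX : ∃ x ∈ N.verts (N.head e) l, x ∈ X
    · obtain ⟨l₁, f, l₂, rfl, h₁, h₂⟩ := ih h.2 hX
      exact ⟨e :: l₁, f, l₂, rfl, ⟨h.1, h₁⟩, h₂⟩
    · push Not at hX
      obtain ⟨x, hx, hxX⟩ := ha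
      rw [verts_cons, List.mem_cons] at hx
      have hxa : x = a := hx.resolve_right fun h' => hX x h' hxX
      subst hxa
      refine ⟨[], e, l, rfl, h.1.symm, h.1 ▸ hxX, h.2, fun f hf => hX _ ?_⟩
      rw [verts, ← List.map_cons]
      exact List.mem_map_of_mem hf

/-- Once outside a set that no edge of it enters, a walk stays outside. -/
theorem IsWalk.tail_notMem {a b : V} {l : List E} (h : N.IsWalk a l b) {X : Set V} (ha : a ∉ X)
    (hX : ∀ e ∈ l, N.head e ∈ X → N.tail e ∈ X) {e : E} (he : e ∈ l) : N.tail e ∉ X := by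
  induction l generalizing a with
  | nil => simp at he
  | cons f l ih =>
    have hf : N.tail f ∉ X := h.1 ▸ ha
    rcases List.mem_cons.1 he with rfl | he
    · exact hf
    · exact ih h.2 (fun h' => hf (hX f (by simp) h')) (fun e he => hX e (by simp [he])) he

/-- A walk that starts in a set, ends outside it and never enters it leaves it exactly once. -/
theorem IsWalk.existsUnique_crossing {a b : V} {l : List E} (h : N.IsWalk a l b) {X : Set V}
    (ha : a ∈ X) (hb : b ∉ X) (hX : ∀ e ∈ l, N.head e ∈ X → N.tail e ∈ X) :
    ∃! e, e ∈ l ∧ N.tail e ∈ X ∧ N.head e ∉ X := by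
  induction l generalizing a with
  | nil => exact absurd ((show a = b from h) ▸ ha) hb
  | cons f l ih =>
    have hX' : ∀ e ∈ l, N.head e ∈ X → N.tail e ∈ X := fun e he => hX e (by simp [he])
    have hf : N.tail f ∈ X := h.1 ▸ ha
    by_cases hfX : N.head f ∈ X
    · obtain ⟨e, ⟨he, h₁, h₂⟩, hu⟩ := ih h.2 hfX hX'
      refine ⟨e, ⟨by simp [he], h₁, h₂⟩, ?_⟩
      rintro g ⟨hg, hg₁, hg₂⟩
      rcases List.mem_cons.1 hg with rfl | hg
      · exact absurd hfX hg₂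
      · exact hu g ⟨hg, hg₁, hg₂⟩
    · refine ⟨f, ⟨by simp, hf, hfX⟩, ?_⟩
      rintro g ⟨hg, hg₁, hg₂⟩
      rcases List.mem_cons.1 hg with rfl | hg
      · rfl
      · exact absurd hg₁ (h.2.tail_notMem hfX hX' hg)

end Walk

/-! ### Ears and obstructions. -/

section Obstruction

variable {V : Type u} {E : Type v} {N : Network V E}

/-- The three kinds of source-sink paths of a subnetwork on which some game has no strong
equilibrium. -/
structure IsObstruction (N : Network V E) (H : Set E) (a b c d : E) : Prop where
  types : ∀ l, N.IsSTPath l → (∀ e ∈ l, e ∈ H) →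
    (a ∈ l ∧ b ∈ l ∧ c ∉ l ∧ d ∉ l) ∨ (a ∈ l ∧ b ∉ l ∧ c ∈ l ∧ d ∉ l) ∨
      (a ∉ l ∧ b ∉ l ∧ c ∉ l ∧ d ∈ l)
  first : ∃ l, N.IsSTPath l ∧ (∀ e ∈ l, e ∈ H) ∧ a ∈ l ∧ b ∈ l
  second : ∃ l, N.IsSTPath l ∧ (∀ e ∈ l, e ∈ H) ∧ a ∈ l ∧ c ∈ l
  third : ∃ l, N.IsSTPath l ∧ (∀ e ∈ l, e ∈ H) ∧ d ∈ l

/-- A path with two ears, the first of which starts strictly before the second and returns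
strictly after the start of the second, gives an obstruction. -/
theorem isObstruction_of_ears {p u : V} {A B C D D' : List E} {a b c d : E}
    (hA : N.IsWalk N.source A p) (hB : N.IsWalk p (a :: B) u)
    (hC : N.IsWalk u (b :: C) N.sink) (hR : (N.visited (A ++ a :: B ++ b :: C)).Nodup)
    (hD : N.IsWalk u (c :: D) N.sink)
    (hDX : ∀ e ∈ c :: D, N.head e ∉ N.verts N.source (A ++ a :: B)) (hbc : b ≠ c)
    (hD' : N.IsWalk p (d :: D') N.sink)
    (hDX' : ∀ e ∈ d :: D', N.head e ∉ N.verts N.source (A ++ a :: B)) :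
    N.IsObstruction {e | e ∈ A ++ a :: B ++ b :: C ∨ e ∈ c :: D ∨ e ∈ d :: D'} a b c d := by
  set H : Set E := {e | e ∈ A ++ a :: B ++ b :: C ∨ e ∈ c :: D ∨ e ∈ d :: D'} with hH
  rw [visited_eq] at hR
  have hAB := nodup_left hR
  -- `X₁ ⊆ X₂` are nested cuts, ending at `p` and at `u`. No edge of `H` enters either of them; only
  -- `a` and `d` leave `X₁`, and only `b`, `c` and `d` leave `X₂`.
  set X₁ : Set V := {x | x ∈ N.verts N.source A}
  set X₂ : Set V := {x | x ∈ N.verts N.source (A ++ a :: B)} with hX₂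
  have h12 : X₁ ⊆ X₂ := fun x hx => by
    simp only [hX₂, Set.mem_ofPred_eq, verts_append]
    exact List.mem_append_left _ hx
  have hA₁ : ∀ e ∈ A, N.tail e ∈ X₁ ∧ N.head e ∈ X₁ := fun e he =>
    ⟨hA.tail_mem_verts he, head_mem_verts he⟩
  have hB₁ : ∀ e ∈ a :: B, N.head e ∉ X₁ := fun e he => head_notMem_of_nodup hAB he
  have hB₂ : ∀ e ∈ a :: B, N.tail e ∈ X₂ ∧ N.head e ∈ X₂ := fun e he =>
    ⟨(hA.append hB).tail_mem_verts (by simp_all), head_mem_verts (by simp_all)⟩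
  have hC₂ : ∀ e ∈ b :: C, N.head e ∉ X₂ := fun e he => head_notMem_of_nodup hR he
  have hp : p ∈ X₁ := hA.end_mem_verts
  have hu : u ∈ X₂ := (hA.append hB).end_mem_verts
  have hu₁ : u ∉ X₁ := by
    obtain ⟨e, he, rfl⟩ := hB.end_mem_heads (by simp)
    exact hB₁ e he
  -- tails of the edges after the first one of a walk avoid whatever the heads avoid
  have key : ∀ {x y : V} {f : E} {l : List E} {X : Set V}, N.IsWalk x (f :: l) y →
      (∀ e ∈ f :: l, N.head e ∉ X) → ∀ e ∈ l, N.tail e ∉ X := by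
    intro x y f l X hw hh e he
    have := hw.2.tail_mem_verts he
    rw [verts, ← List.map_cons, List.mem_map] at this
    obtain ⟨g, hg, hge⟩ := this
    exact hge ▸ hh g hg
  have hBt : ∀ e ∈ B, N.tail e ∉ X₁ := key hB hB₁
  have hCt : ∀ e ∈ C, N.tail e ∉ X₂ := key hC hC₂
  have hDt : ∀ e ∈ D, N.tail e ∉ X₂ := key hD hDX
  have hDt' : ∀ e ∈ D', N.tail e ∉ X₂ := key hD' hDX'
  have ta : N.tail a = p := hB.1
  have tb : N.tail b = u := hC.1
  have tc : N.tail c = u := hD.1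
  have td : N.tail d = p := hD'.1
  have hs₁ : N.source ∈ X₁ := start_mem_verts _ _
  have ht₂ : N.sink ∉ X₂ := by
    obtain ⟨e, he, h⟩ := hC.end_mem_heads (by simp)
    exact h ▸ hC₂ e he
  have ha₁ := hB₁ a (by simp)
  have ha₂ := hB₂ a (by simp)
  have hb₂ := hC₂ b (by simp)
  have hc₂ := hDX c (by simp)
  have hd₂ := hDX' d (by simp)
  have enter₁ : ∀ e ∈ H, N.head e ∈ X₁ → N.tail e ∈ X₁ := by
    intro e he h
    simp only [hH, Set.mem_ofPred_eq, List.append_assoc, List.mem_append] at he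
    rcases he with (he | he | he) | he | he
    · exact (hA₁ e he).1
    · exact absurd h (hB₁ e he)
    · exact absurd (h12 h) (hC₂ e he)
    · exact absurd (h12 h) (hDX e he)
    · exact absurd (h12 h) (hDX' e he)
  have enter₂ : ∀ e ∈ H, N.head e ∈ X₂ → N.tail e ∈ X₂ := by
    intro e he h
    simp only [hH, Set.mem_ofPred_eq, List.append_assoc, List.mem_append] at he
    rcases he with (he | he | he) | he | he
    · exact h12 (hA₁ e he).1
    · exact (hB₂ e he).1
    · exact absurd h (hC₂ e he)
    · exact absurd h (hDX e he)
    · exact absurd h (hDX' e he)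
  have cross₁ : ∀ e ∈ H, N.tail e ∈ X₁ → N.head e ∉ X₁ → e = a ∨ e = d := by
    intro e he h h'
    simp only [hH, Set.mem_ofPred_eq, List.append_assoc, List.mem_append, List.mem_cons] at he
    rcases he with (he | (rfl | he) | (rfl | he)) | (rfl | he) | (rfl | he)
    · exact absurd (hA₁ e he).2 h'
    · simp
    · exact absurd h (hBt e he)
    · exact absurd h (tb ▸ hu₁)
    · exact absurd (h12 h) (hCt e he)
    · exact absurd h (tc ▸ hu₁)
    · exact absurd (h12 h) (hDt e he)
    · simp
    · exact absurd (h12 h) (hDt' e he)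
  have cross₂ : ∀ e ∈ H, N.tail e ∈ X₂ → N.head e ∉ X₂ → e = b ∨ e = c ∨ e = d := by
    intro e he h h'
    simp only [hH, Set.mem_ofPred_eq, List.append_assoc, List.mem_append, List.mem_cons] at he
    rcases he with (he | he | (rfl | he)) | (rfl | he) | (rfl | he)
    · exact absurd (h12 (hA₁ e he).2) h'
    · exact absurd (hB₂ e (by simpa using he)).2 h'
    · simp
    · exact absurd h (hCt e he)
    · simp
    · exact absurd h (hDt e he)
    · simp
    · exact absurd h (hDt' e he)
  have had : a ≠ d := by rintro rfl; exact hd₂ ha₂.2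
  have hbd : b ≠ d := by rintro rfl; exact hu₁ (tb.symm.trans td ▸ hp)
  have hcd : c ≠ d := by rintro rfl; exact hu₁ (tc.symm.trans td ▸ hp)
  have types : ∀ l, N.IsSTPath l → (∀ e ∈ l, e ∈ H) →
    (a ∈ l ∧ b ∈ l ∧ c ∉ l ∧ d ∉ l) ∨ (a ∈ l ∧ b ∉ l ∧ c ∈ l ∧ d ∉ l) ∨
      (a ∉ l ∧ b ∉ l ∧ c ∉ l ∧ d ∈ l) := by
    intro l hl hlH
    obtain ⟨e, ⟨he, he₁, he₂⟩, hu⟩ := hl.1.existsUnique_crossing hs₁ (fun h => ht₂ (h12 h))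
      (fun e he => enter₁ e (hlH e he))
    obtain ⟨f, ⟨hf, hf₁, hf₂⟩, hu'⟩ := hl.1.existsUnique_crossing (h12 hs₁) ht₂
      (fun e he => enter₂ e (hlH e he))
    have ka : a ∈ l → a = e := fun h => hu a ⟨h, ta ▸ hp, ha₁⟩
    have kd : d ∈ l → d = e := fun h => hu d ⟨h, td ▸ hp, fun h => hd₂ (h12 h)⟩
    have kb' : b ∈ l → b = f := fun h => hu' b ⟨h, tb ▸ ‹u ∈ X₂›, hb₂⟩
    have kc' : c ∈ l → c = f := fun h => hu' c ⟨h, tc ▸ ‹u ∈ X₂›, hc₂⟩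
    have kd' : d ∈ l → d = f := fun h => hu' d ⟨h, td ▸ h12 hp, hd₂⟩
    -- Each cut is crossed exactly once and `d` crosses both. So a path leaves both cuts by `d`, or
    -- leaves `X₁` by `a` and `X₂` by `b` or `c`.
    rcases cross₁ e (hlH e he) he₁ he₂ with rfl | rfl <;>
    rcases cross₂ f (hlH f hf) hf₁ hf₂ with rfl | rfl | rfl <;> grind
  -- The ears are not assumed simple, so a walk along them is shortened to a path. Its type is then
  -- found by excluding the other types.
  have sub : ∀ l, N.IsWalk N.source l N.sink → (∀ e ∈ l, e ∈ H) →
      ∃ l', N.IsSTPath l' ∧ (∀ e ∈ l', e ∈ H) ∧ l' ⊆ l := by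
    intro l hl hlH
    obtain ⟨l', h₁, h₂, h₃⟩ := hl.exists_simple
    exact ⟨l', ⟨h₂, h₃⟩, fun e he => hlH e (h₁ he), h₁⟩
  refine ⟨types, ?_, ?_, ?_⟩
  · exact ⟨A ++ a :: B ++ b :: C, ⟨(hA.append hB).append hC, hR⟩,
      fun e he => Or.inl he, by simp, by simp⟩
  · obtain ⟨l, hl, hlH, hsub⟩ := sub ((A ++ a :: B) ++ c :: D) ((hA.append hB).append hD)
      (fun e he => by simp only [hH, Set.mem_ofPred_eq]; grind)
    have hb : b ∉ l := fun h => by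
      have := hsub h
      simp only [List.append_assoc, List.mem_append, List.mem_cons (a := b) (b := c)] at this
      rcases this with h | h | h | h
      · exact hb₂ (h12 (hA₁ b h).2)
      · exact hb₂ (hB₂ b h).2
      · exact hbc h
      · exact hDt b h (tb ▸ hu)
    have hd : d ∉ l := fun h => by
      have := hsub h
      simp only [List.append_assoc, List.mem_append, List.mem_cons (a := d) (b := c)] at this
      rcases this with h | h | h | h
      · exact hd₂ (h12 (hA₁ d h).2)
      · exact hd₂ (hB₂ d h).2
      · exact hcd h.symm
      · exact hDt d h (td ▸ h12 hp)
    rcases types l hl hlH with h | h | h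
    · exact absurd h.2.1 hb
    · exact ⟨l, hl, hlH, h.1, h.2.2.1⟩
    · exact absurd h.2.2.2 hd
  · obtain ⟨l, hl, hlH, hsub⟩ := sub (A ++ d :: D') (hA.append hD')
      (fun e he => by simp only [hH, Set.mem_ofPred_eq]; grind)
    have ha : a ∉ l := fun h => by
      have := hsub h
      simp only [List.mem_append, List.mem_cons (a := a) (b := d)] at this
      rcases this with h | h | h
      · exact ha₁ (hA₁ a h).2
      · exact had h
      · exact hDt' a h (ta ▸ h12 hp)
    rcases types l hl hlH with h | h | h
    · exact absurd h.1 ha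
    · exact absurd h.1 ha
    · exact ⟨l, hl, hlH, h.2.2.2⟩

/-- A vertex with two outgoing edges that some source-sink path avoids gives an obstruction. -/
theorem exists_isObstruction_of_two_out {e₁ e₂ : E} {R₁ R₂ Q : List E} (he : e₁ ≠ e₂)
    (ht : N.tail e₁ = N.tail e₂) (h₁ : N.IsSTPath R₁) (he₁ : e₁ ∈ R₁) (h₂ : N.IsSTPath R₂)
    (he₂ : e₂ ∈ R₂) (hQ : N.IsSTPath Q) (hw : N.tail e₁ ∉ N.visited Q) :
    ∃ H a b c d, N.IsObstruction H a b c d := by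
  obtain ⟨P₁, S₁, rfl⟩ := List.append_of_mem he₁
  obtain ⟨P₂, S₂, rfl⟩ := List.append_of_mem he₂
  obtain ⟨⟨w, hP₁, hS₁⟩, hn₁⟩ := h₁.imp_left isWalk_append.1
  obtain ⟨⟨w₂, hP₂, hS₂⟩, hn₂⟩ := h₂.imp_left isWalk_append.1
  obtain rfl : w₂ = w := hS₂.1.symm.trans (ht.symm.trans hS₁.1)
  rename' w₂ => w
  rw [hS₁.1] at hw
  rw [visited_eq] at hn₁ hn₂ hw
  have hS₁P : ∀ e ∈ e₁ :: S₁, N.head e ∉ N.verts N.source P₁ :=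
    fun e he => head_notMem_of_nodup hn₁ he
  have hS₂P : ∀ e ∈ e₂ :: S₂, N.head e ∉ N.verts N.source P₂ :=
    fun e he => head_notMem_of_nodup hn₂ he
  have hwS₂ : ∀ e ∈ e₂ :: S₂, N.head e ≠ w := fun e he h => hS₂P e he (h ▸ hP₂.end_mem_verts)
  have htP : N.sink ∉ N.verts N.source P₁ := by
    obtain ⟨e, he, h⟩ := hS₁.end_mem_heads (by simp)
    exact h ▸ hS₁P e he
  -- If `S₂` never returns to `P₁`, it is the ear at `w`, and the last exit of `Q` from `P₁` starts
  -- the other ear; this exit lies strictly before `w` because `Q` avoids `w`.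
  by_cases hS : ∀ e ∈ e₂ :: S₂, N.head e ∉ N.verts N.source P₁
  · obtain ⟨Q₁, d, Q₂, rfl, hQ₁, hd, hQ₂, hQX⟩ := hQ.1.last_exit {x | x ∈ N.verts N.source P₁}
      ⟨_, start_mem_verts _ _, start_mem_verts _ _⟩ htP
    obtain ⟨A, B, rfl, hA, hB⟩ := hP₁.split hd
    cases B with
    | nil =>
      refine absurd ?_ hw
      rw [← show N.tail d = w from hB]
      exact hQ.1.tail_mem_verts (by simp)
    | cons a B =>
      exact ⟨_, a, e₁, e₂, d, isObstruction_of_ears hA hB hS₁ hn₁ hS₂ hS he ⟨rfl, hQ₂⟩ hQX⟩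
  · push Not at hS
    obtain ⟨f, hf, hfP⟩ := hS
    -- Otherwise the later ear is the part of `S₂` after its last exit from `P₁`, at a vertex
    -- `N.tail c` strictly before `w`.
    obtain ⟨L₁, c, L₂, hL, hL₁, hc, hL₂, hLX⟩ := hS₂.last_exit {x | x ∈ N.verts N.source P₁}
      ⟨_, head_mem_verts hf, hfP⟩ htP
    have hcw : N.tail c ≠ w := by
      intro h
      cases L₁ with
      | nil => exact hLX f (by simpa [hL] using hf) hfP
      | cons g L₁ =>
        obtain ⟨e, he, h'⟩ := hL₁.end_mem_heads (by simp)
        exact hwS₂ e (hL ▸ List.mem_append_left _ he) (h'.trans h)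
    have hcS : ∃ e ∈ e₂ :: S₂, N.head e = N.tail c := by
      cases L₁ with
      | nil => exact absurd (show w = N.tail c from hL₁).symm hcw
      | cons g L₁ =>
        obtain ⟨e, he, h'⟩ := hL₁.end_mem_heads (by simp)
        exact ⟨e, hL ▸ List.mem_append_left _ he, h'⟩
    obtain ⟨AB, B', rfl, hAB, hB'⟩ := hP₁.split hc
    cases B' with
    | nil => exact absurd hB' hcw
    | cons b B' =>
      have hn := nodup_left hn₁
      have hwAB : w ∉ N.verts N.source AB := by
        obtain ⟨e, he, h⟩ := hB'.end_mem_heads (by simp)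
        exact h ▸ head_notMem_of_nodup hn he
      -- The earlier ear follows `P₂` to `w` and then `S₁`. It starts strictly before `N.tail c`,
      -- since that vertex lies on `S₂` and hence not on `P₂`.
      obtain ⟨L₃, d, L₄, rfl, hL₃, hd, hL₄, hLX'⟩ := hP₂.last_exit {x | x ∈ N.verts N.source AB}
        ⟨_, start_mem_verts _ _, start_mem_verts _ _⟩ hwAB
      obtain ⟨A, B, rfl, hA, hB⟩ := hAB.split hd
      cases B with
      | nil =>
        obtain ⟨e, he, h⟩ := hcS
        refine absurd (hP₂.tail_mem_verts (e := d) (by simp)) ?_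
        rw [show N.tail d = N.tail c from hB, ← h]
        exact hS₂P e he
      | cons a B =>
        have hsub : ∀ x, x ∈ N.verts N.source (A ++ a :: B) →
            x ∈ N.verts N.source (A ++ a :: B ++ b :: B') := fun x hx => by
          rw [verts_append]; exact List.mem_append_left _ hx
        refine ⟨_, a, b, c, d, isObstruction_of_ears (C := B' ++ e₁ :: S₁) (D := L₂)
          (D' := L₄ ++ e₁ :: S₁) hA hB (hB'.append hS₁) ?_ ⟨rfl, hL₂⟩
          (fun e he h => hLX e he (hsub _ h)) ?_ ⟨rfl, hL₄.append hS₁⟩ ?_⟩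
        · rw [visited_eq]
          simpa using hn₁
        · rintro rfl
          exact hLX b (by simp) (head_mem_verts (by simp))
        · intro e he h
          rw [← List.cons_append, List.mem_append] at he
          rcases he with he | he
          · exact hLX' e he h
          · exact hS₁P e he (hsub _ h)

end Obstruction

/-! ### Reversal of all edges. -/

section Reverse

variable {V : Type u} {E : Type v} {N : Network V E}

/-- The network with all edges reversed. -/
def reverse (N : Network V E) : Network V E where
  tail := N.head
  head := N.tail
  source := N.sink
  sink := N.source

theorem IsWalk.reverse {a b : V} {l : List E} (h : N.IsWalk a l b) :
    N.reverse.IsWalk b l.reverse a := by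
  induction l generalizing a with
  | nil => exact (show a = b from h).symm
  | cons e l ih =>
    rw [List.reverse_cons]
    exact (ih h.2).append ⟨rfl, h.1⟩

theorem IsWalk.map_tail_append {a b : V} {l : List E} (h : N.IsWalk a l b) :
    l.map N.tail ++ [b] = N.verts a l := by
  induction l generalizing a with
  | nil => simp [verts, show a = b from h]
  | cons e l ih => rw [List.map_cons, List.cons_append, ih h.2, verts_cons, h.1]

theorem IsWalk.verts_reverse {a b : V} {l : List E} (h : N.IsWalk a l b) :
    N.reverse.verts b l.reverse = (N.verts a l).reverse := by
  rw [← h.map_tail_append]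
  simp [verts, Network.reverse]

theorem IsSTPath.reverse {l : List E} (h : N.IsSTPath l) : N.reverse.IsSTPath l.reverse := by
  refine ⟨h.1.reverse, ?_⟩
  change (N.reverse.verts N.sink l.reverse).Nodup
  rw [h.1.verts_reverse, List.nodup_reverse]
  exact h.2

theorem IsObstruction.of_reverse {H : Set E} {a b c d : E}
    (h : N.reverse.IsObstruction H a b c d) : N.IsObstruction H a b c d := by
  -- `N.reverse.reverse` is `N` by definition.
  have back : ∀ {l}, N.reverse.IsSTPath l → N.IsSTPath l.reverse := fun hl => hl.reverse
  refine ⟨fun l hl hH => ?_, ?_, ?_, ?_⟩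
  · simpa using h.types l.reverse hl.reverse (by simpa using hH)
  · obtain ⟨l, hl, hH, h'⟩ := h.first
    exact ⟨l.reverse, back hl, by simpa using hH, by simpa using h'⟩
  · obtain ⟨l, hl, hH, h'⟩ := h.second
    exact ⟨l.reverse, back hl, by simpa using hH, by simpa using h'⟩
  · obtain ⟨l, hl, hH, h'⟩ := h.third
    exact ⟨l.reverse, back hl, by simpa using hH, by simpa using h'⟩

/-- A vertex with two incoming edges that some source-sink path avoids gives an obstruction. -/
theorem exists_isObstruction_of_two_in {e₁ e₂ : E} {R₁ R₂ Q : List E} (he : e₁ ≠ e₂)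
    (ht : N.head e₁ = N.head e₂) (h₁ : N.IsSTPath R₁) (he₁ : e₁ ∈ R₁) (h₂ : N.IsSTPath R₂)
    (he₂ : e₂ ∈ R₂) (hQ : N.IsSTPath Q) (hw : N.head e₁ ∉ N.visited Q) :
    ∃ H a b c d, N.IsObstruction H a b c d := by
  have hw' : N.reverse.tail e₁ ∉ N.reverse.visited Q.reverse := by
    change N.head e₁ ∉ N.reverse.verts N.sink Q.reverse
    rw [hQ.1.verts_reverse, List.mem_reverse]
    exact hw
  obtain ⟨H, a, b, c, d, h⟩ := exists_isObstruction_of_two_out (N := N.reverse) he ht h₁.reverse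
    (by simpa using he₁) h₂.reverse (by simpa using he₂) hQ.reverse hw'
  exact ⟨H, a, b, c, d, h.of_reverse⟩

end Reverse

/-! ### A game without strong equilibria on an obstruction. -/

namespace CCSGame

variable {V : Type u} {E : Type v} {N : Network V E}

/-- The sum of the fair shares that agent `i` pays in the profile `σ`. -/
noncomputable def share (Δ : CCSGame N) (σ : Δ.Profile) (i : Fin Δ.agents) : ℝ≥0 :=
  ((σ i).1.map fun e => Δ.cost e / (Δ.load σ e : ℝ≥0)).sum

theorem agentCost_of_isFeasible {Δ : CCSGame N} {σ : Δ.Profile} (h : Δ.IsFeasible σ)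
    (i : Fin Δ.agents) : Δ.agentCost σ i = Δ.share σ i := by
  rw [agentCost, if_pos h, share]

theorem agentCost_of_not_isFeasible {Δ : CCSGame N} {σ : Δ.Profile} (h : ¬ Δ.IsFeasible σ)
    (i : Fin Δ.agents) : Δ.agentCost σ i = ⊤ := by
  rw [agentCost, if_neg h]

/-- In an infeasible profile everybody pays `∞`, so the coalition of all agents gains by moving to a
feasible one. -/
theorem IsStrongEquilibrium.isFeasible {Δ : CCSGame N} {σ : Δ.Profile}
    (h : Δ.IsStrongEquilibrium σ) (hΔ : Δ.Feasible) (hn : 0 < Δ.agents) : Δ.IsFeasible σ := by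
  by_contra hσ
  obtain ⟨τ, hτ⟩ := hΔ
  obtain ⟨j, -, hj⟩ := h Finset.univ ⟨⟨0, hn⟩, Finset.mem_univ _⟩ τ (by simp)
  rw [agentCost_of_not_isFeasible hσ, agentCost_of_isFeasible hτ] at hj
  exact absurd hj (by simp)

end CCSGame

namespace IsObstruction

variable {V : Type u} {E : Type v} {N : Network V E} {H : Set E} {a b c d : E}

open Classical in
/-- The two-agent game without strong equilibria on an obstruction. -/
noncomputable def game (N : Network V E) (H : Set E) (a b c d : E) : CCSGame N where
  agents := 2
  -- Alone, the three types of paths cost 8, 10 and 5; sharing `a` lowers the first two to 4 and 6.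
  -- The capacities keep paths in `H` and prevent two agents from using the same type.
  cost e := if e = a then 8 else if e = c then 2 else if e = d then 5 else 0
  capacity e := if e ∈ H then if e = b ∨ e = c ∨ e = d then 1 else 2 else 0

open Classical in
theorem load_game (σ : (game N H a b c d).Profile) (e : E) {i j : Fin (game N H a b c d).agents}
    (hij : i ≠ j) : (game N H a b c d).load σ e =
      (if e ∈ (σ i).1 then 1 else 0) + if e ∈ (σ j).1 then 1 else 0 := by
  have huniv : (Finset.univ : Finset (Fin (game N H a b c d).agents)) = {i, j} :=
    (by decide : ∀ i j : Fin 2, i ≠ j → Finset.univ = {i, j}) i j hij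
  unfold CCSGame.load
  rw [huniv, Finset.card_filter, Finset.sum_pair hij]

theorem sum_map_eq {l : List E} (hl : l.Nodup) {a c d : E} {f : E → ℝ≥0}
    (hf : ∀ e, e ≠ a → e ≠ c → e ≠ d → f e = 0) (hac : a ≠ c) (had : a ≠ d) (hcd : c ≠ d) :
    open Classical in
    (l.map f).sum = (if a ∈ l then f a else 0) + (if c ∈ l then f c else 0) +
      if d ∈ l then f d else 0 := by
  classical
  rw [← List.sum_toFinset f hl]
  have : ∀ e, f e = (if e = a then f a else 0) + (if e = c then f c else 0) +
      if e = d then f d else 0 := by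
    intro e
    by_cases h₁ : e = a
    · subst h₁; simp [hac, had]
    · by_cases h₂ : e = c
      · subst h₂; simp [h₁, hcd]
      · by_cases h₃ : e = d
        · subst h₃; simp [h₁, h₂]
        · simp [h₁, h₂, h₃, hf e h₁ h₂ h₃]
  rw [Finset.sum_congr rfl fun e _ => this e]
  simp [Finset.sum_add_distrib, Finset.sum_ite_eq']

theorem ne (h : N.IsObstruction H a b c d) : a ≠ c ∧ a ≠ d ∧ c ≠ d := by
  obtain ⟨l₁, hl₁, hH₁, ha₁, hb₁⟩ := h.first
  obtain ⟨l₂, hl₂, hH₂, ha₂, hb₂⟩ := h.second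
  have h₁ := h.types l₁ hl₁ hH₁
  have h₂ := h.types l₂ hl₂ hH₂
  refine ⟨?_, ?_, ?_⟩ <;> rintro rfl <;> tauto

/-- Capacity 2 never binds two agents, capacity 0 forces the paths into `H`, and capacity 1 forbids
sharing `b`, `c` or `d`. -/
theorem isFeasible_game_iff {σ : (game N H a b c d).Profile}
    {i j : Fin (game N H a b c d).agents} (hij : i ≠ j) :
    (game N H a b c d).IsFeasible σ ↔ (∀ e ∈ (σ i).1, e ∈ H) ∧ (∀ e ∈ (σ j).1, e ∈ H) ∧
      ∀ e, e = b ∨ e = c ∨ e = d → ¬ (e ∈ (σ i).1 ∧ e ∈ (σ j).1) := by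
  classical
  have hcap : ∀ e, (game N H a b c d).capacity e =
      if e ∈ H then if e = b ∨ e = c ∨ e = d then 1 else 2 else 0 := fun e => by
    simp only [game]
  simp only [CCSGame.IsFeasible, load_game σ _ hij, hcap]
  constructor
  · intro h
    refine ⟨fun e he => ?_, fun e he => ?_, fun e he h' => ?_⟩ <;> specialize h e <;>
      by_contra hH <;> simp_all
    by_cases hH : e ∈ H <;> simp [hH] at h
  · rintro ⟨h₁, h₂, h₃⟩ e
    have k₁ := h₁ e
    have k₂ := h₂ e
    have k₃ := h₃ e
    by_cases e ∈ (σ i).1 <;> by_cases e ∈ (σ j).1 <;> by_cases e = b ∨ e = c ∨ e = d <;> simp_all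

open Classical in
theorem share_game (h : N.IsObstruction H a b c d) (σ : (game N H a b c d).Profile)
    {i j : Fin (game N H a b c d).agents} (hij : i ≠ j) :
    (game N H a b c d).share σ i =
      (if a ∈ (σ i).1 then 8 / (1 + if a ∈ (σ j).1 then 1 else 0) else 0) +
      (if c ∈ (σ i).1 then 2 / (1 + if c ∈ (σ j).1 then 1 else 0) else 0) +
      if d ∈ (σ i).1 then 5 / (1 + if d ∈ (σ j).1 then 1 else 0) else 0 := by
  obtain ⟨hac, had, hcd⟩ := h.ne
  have hcost : ∀ e, (game N H a b c d).cost e =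
      if e = a then 8 else if e = c then 2 else if e = d then 5 else 0 := fun e => by
    simp only [game]
  rw [CCSGame.share, sum_map_eq (nodup_of_nodup_verts (σ i).2.2)
    (fun e h₁ h₂ h₃ => by rw [hcost, if_neg h₁, if_neg h₂, if_neg h₃, zero_div]) hac had hcd]
  simp only [hcost, load_game σ _ hij]
  congr 1
  · congr 1
    · split_ifs <;> simp [one_add_one_eq_two]
    · split_ifs <;> simp_all [one_add_one_eq_two]
  · split_ifs <;> simp_all [one_add_one_eq_two]

theorem mem_types {l : List E} (h : N.IsObstruction H a b c d) (hl : N.IsSTPath l)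
    (hH : ∀ e ∈ l, e ∈ H) :
    (b ∈ l → a ∈ l ∧ b ∈ l ∧ c ∉ l ∧ d ∉ l) ∧ (c ∈ l → a ∈ l ∧ b ∉ l ∧ c ∈ l ∧ d ∉ l) ∧
      (d ∈ l → a ∉ l ∧ b ∉ l ∧ c ∉ l ∧ d ∈ l) := by
  have := h.types l hl hH
  tauto

theorem feasible_game (h : N.IsObstruction H a b c d) : (game N H a b c d).Feasible := by
  classical
  obtain ⟨l₁, hl₁, hH₁, ha₁, hb₁⟩ := h.first
  obtain ⟨l₂, hl₂, hH₂, ha₂, hc₂⟩ := h.second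
  have t₁ := (h.mem_types hl₁ hH₁).1 hb₁
  have t₂ := (h.mem_types hl₂ hH₂).2.1 hc₂
  let i : Fin (game N H a b c d).agents := (0 : Fin 2)
  let j : Fin (game N H a b c d).agents := (1 : Fin 2)
  have hij : i ≠ j := (by decide : (0 : Fin 2) ≠ 1)
  let σ : (game N H a b c d).Profile := fun k => if k = i then ⟨l₁, hl₁⟩ else ⟨l₂, hl₂⟩
  have hi : σ i = ⟨l₁, hl₁⟩ := if_pos rfl
  have hj : σ j = ⟨l₂, hl₂⟩ := if_neg hij.symm
  refine ⟨σ, (isFeasible_game_iff hij).2 ?_⟩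
  rw [hi, hj]
  refine ⟨hH₁, hH₂, ?_⟩
  rintro e (rfl | rfl | rfl)
  · exact fun h => t₂.2.1 h.2
  · exact fun h => t₁.2.2.1 h.1
  · exact fun h => t₁.2.2.2 h.1

/-- In a strong equilibrium the two agents have no profitable joint deviation; the second agent
does not count if she does not move. -/
theorem exists_deviation {σ : (game N H a b c d).Profile}
    (hσ : (game N H a b c d).IsStrongEquilibrium σ) (hσf : (game N H a b c d).IsFeasible σ)
    {i j : Fin (game N H a b c d).agents} (hij : i ≠ j) (S T : N.Strategy)
    (hS : ∀ e ∈ S.1, e ∈ H) (hT : ∀ e ∈ T.1, e ∈ H)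
    (hST : ∀ e, e = b ∨ e = c ∨ e = d → ¬ (e ∈ S.1 ∧ e ∈ T.1)) :
    ∃ τ : (game N H a b c d).Profile, τ i = S ∧ τ j = T ∧
      ((game N H a b c d).share σ i ≤ (game N H a b c d).share τ i ∨
        T ≠ σ j ∧ (game N H a b c d).share σ j ≤ (game N H a b c d).share τ j) := by
  classical
  let τ : (game N H a b c d).Profile := fun k => if k = i then S else T
  have hτi : τ i = S := if_pos rfl
  have hτj : τ j = T := if_neg hij.symm
  have hτ : (game N H a b c d).IsFeasible τ :=
    (isFeasible_game_iff hij).2 (by rw [hτi, hτj]; exact ⟨hS, hT, hST⟩)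
  have hk : ∀ k, k = i ∨ k = j := fun k =>
    (by decide : ∀ i j k : Fin 2, i ≠ j → k = i ∨ k = j) i j k hij
  have hle : ∀ k, (game N H a b c d).agentCost σ k ≤ (game N H a b c d).agentCost τ k →
      (game N H a b c d).share σ k ≤ (game N H a b c d).share τ k := fun k h => by
    rwa [CCSGame.agentCost_of_isFeasible hσf, CCSGame.agentCost_of_isFeasible hτ,
      ENNReal.coe_le_coe] at h
  refine ⟨τ, hτi, hτj, ?_⟩
  -- If `j` does not move, the coalition is `{i}` and only `i` can refuse.
  by_cases hTj : T = σ j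
  · obtain ⟨k, hk', h⟩ := hσ {i} ⟨i, Finset.mem_singleton_self i⟩ τ fun k hki => by
      rcases hk k with rfl | rfl
      · exact absurd (Finset.mem_singleton_self k) hki
      · rw [hτj, hTj]
    rw [Finset.mem_singleton.1 hk'] at h
    exact Or.inl (hle i h)
  · obtain ⟨k, -, h⟩ := hσ Finset.univ ⟨i, Finset.mem_univ i⟩ τ
      fun k hk => absurd (Finset.mem_univ k) hk
    rcases hk k with rfl | rfl
    · exact Or.inl (hle k h)
    · exact Or.inr ⟨hTj, hle k h⟩

/-- The agent on `a, c` pays 4 + 2 and moves alone to `d` for 5. -/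
theorem false_of_first_second (h : N.IsObstruction H a b c d) {σ : (game N H a b c d).Profile}
    (hσ : (game N H a b c d).IsStrongEquilibrium σ) (hσf : (game N H a b c d).IsFeasible σ)
    {i j : Fin (game N H a b c d).agents} (hij : i ≠ j) (hi : b ∈ (σ i).1) (hj : c ∈ (σ j).1) :
    False := by
  obtain ⟨hHi, hHj, -⟩ := (isFeasible_game_iff hij).1 hσf
  obtain ⟨l, hl, hH, hd⟩ := h.third
  have ti := (h.mem_types (σ i).2 hHi).1 hi
  have tj := (h.mem_types (σ j).2 hHj).2.1 hj
  have tl := (h.mem_types hl hH).2.2 hd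
  obtain ⟨τ, hτj, hτi, hτ | hτ⟩ := exists_deviation hσ hσf hij.symm ⟨l, hl⟩ (σ i) hH hHi
    (by rintro e (rfl | rfl | rfl) <;> tauto)
  · rw [share_game h _ hij.symm, share_game h _ hij.symm, hτi, hτj] at hτ
    simp only [ti, tj, tl, if_true, if_false] at hτ
    revert hτ
    rw [imp_false, not_le, ← NNReal.coe_lt_coe]
    push_cast
    norm_num
  · exact hτ.1 rfl

/-- The only case that needs a joint deviation: `i` goes from 8 to 4 + 2 on `a, c`, while `j` goes
from 5 to 4 on `a, b`. -/
theorem false_of_first_third (h : N.IsObstruction H a b c d) {σ : (game N H a b c d).Profile}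
    (hσ : (game N H a b c d).IsStrongEquilibrium σ) (hσf : (game N H a b c d).IsFeasible σ)
    {i j : Fin (game N H a b c d).agents} (hij : i ≠ j) (hi : b ∈ (σ i).1) (hj : d ∈ (σ j).1) :
    False := by
  obtain ⟨hHi, hHj, -⟩ := (isFeasible_game_iff hij).1 hσf
  obtain ⟨l₁, hl₁, hH₁, -, hb⟩ := h.first
  obtain ⟨l₂, hl₂, hH₂, -, hc⟩ := h.second
  have ti := (h.mem_types (σ i).2 hHi).1 hi
  have tj := (h.mem_types (σ j).2 hHj).2.2 hj
  have t₁ := (h.mem_types hl₁ hH₁).1 hb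
  have t₂ := (h.mem_types hl₂ hH₂).2.1 hc
  obtain ⟨τ, hτi, hτj, hτ | ⟨-, hτ⟩⟩ := exists_deviation hσ hσf hij ⟨l₂, hl₂⟩ ⟨l₁, hl₁⟩ hH₂ hH₁
    (by rintro e (rfl | rfl | rfl) <;> tauto)
  · rw [share_game h _ hij, share_game h _ hij, hτi, hτj] at hτ
    simp only [ti, tj, t₁, t₂, if_true, if_false] at hτ
    revert hτ
    rw [imp_false, not_le, ← NNReal.coe_lt_coe]
    push_cast
    norm_num
  · rw [share_game h _ hij.symm, share_game h _ hij.symm, hτi, hτj] at hτ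
    simp only [ti, tj, t₁, t₂, if_true, if_false] at hτ
    revert hτ
    rw [imp_false, not_le, ← NNReal.coe_lt_coe]
    push_cast
    norm_num

/-- The agent on `a, c` pays 8 + 2 and moves alone to `a, b` for 8. -/
theorem false_of_second_third (h : N.IsObstruction H a b c d) {σ : (game N H a b c d).Profile}
    (hσ : (game N H a b c d).IsStrongEquilibrium σ) (hσf : (game N H a b c d).IsFeasible σ)
    {i j : Fin (game N H a b c d).agents} (hij : i ≠ j) (hi : c ∈ (σ i).1) (hj : d ∈ (σ j).1) :
    False := by
  obtain ⟨hHi, hHj, -⟩ := (isFeasible_game_iff hij).1 hσf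
  obtain ⟨l, hl, hH, -, hb⟩ := h.first
  have ti := (h.mem_types (σ i).2 hHi).2.1 hi
  have tj := (h.mem_types (σ j).2 hHj).2.2 hj
  have tl := (h.mem_types hl hH).1 hb
  obtain ⟨τ, hτi, hτj, hτ | hτ⟩ := exists_deviation hσ hσf hij ⟨l, hl⟩ (σ j) hH hHj
    (by rintro e (rfl | rfl | rfl) <;> tauto)
  · rw [share_game h _ hij, share_game h _ hij, hτi, hτj] at hτ
    simp only [ti, tj, tl, if_true, if_false] at hτ
    revert hτ
    rw [imp_false, not_le, ← NNReal.coe_lt_coe]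
    push_cast
    norm_num
  · exact hτ.1 rfl

theorem not_admitsSE (h : N.IsObstruction H a b c d) : ¬ N.AdmitsSE := by
  intro hSE
  obtain ⟨σ, hσ⟩ := hSE (game N H a b c d) h.feasible_game
  have hσf := hσ.isFeasible h.feasible_game (show 0 < 2 by norm_num)
  let i : Fin (game N H a b c d).agents := (0 : Fin 2)
  let j : Fin (game N H a b c d).agents := (1 : Fin 2)
  have hij : i ≠ j := (by decide : (0 : Fin 2) ≠ 1)
  obtain ⟨hHi, hHj, hST⟩ := (isFeasible_game_iff hij).1 hσf
  rcases h.types _ (σ i).2 hHi with ⟨-, hi, -⟩ | ⟨-, -, hi, -⟩ | ⟨-, -, -, hi⟩ <;>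
    rcases h.types _ (σ j).2 hHj with ⟨-, hj, -⟩ | ⟨-, -, hj, -⟩ | ⟨-, -, -, hj⟩
  · exact hST b (by simp) ⟨hi, hj⟩
  · exact h.false_of_first_second hσ hσf hij hi hj
  · exact h.false_of_first_third hσ hσf hij hi hj
  · exact h.false_of_first_second hσ hσf hij.symm hj hi
  · exact hST c (by simp) ⟨hi, hj⟩
  · exact h.false_of_second_third hσ hσf hij hi hj
  · exact h.false_of_first_third hσ hσf hij.symm hj hi
  · exact h.false_of_second_third hσ hσf hij.symm hj hi
  · exact hST d (by simp) ⟨hi, hj⟩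

end IsObstruction

/-! ### Subnetworks and recognition of compositions. -/

section Restrict

variable {V : Type u} {E : Type v} {N : Network V E}

/-- An isomorphism from a bijection of the vertices and one of the edges. -/
noncomputable def Iso.ofBijective {V' : Type u'} {E' : Type v'} {N' : Network V' E'} {f : V' → V}
    (hf : f.Bijective) (g : E' ≃ E) (ht : ∀ e, f (N'.tail e) = N.tail (g e))
    (hh : ∀ e, f (N'.head e) = N.head (g e)) (hs : f N'.source = N.source)
    (hk : f N'.sink = N.sink) : N.Iso N' where
  vertexEquiv := (Equiv.ofBijective f hf).symm
  edgeEquiv := g.symm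
  map_tail e := by
    rw [Equiv.symm_apply_eq, Equiv.ofBijective_apply, ht, Equiv.apply_symm_apply]
  map_head e := by
    rw [Equiv.symm_apply_eq, Equiv.ofBijective_apply, hh, Equiv.apply_symm_apply]
  map_source := by rw [Equiv.symm_apply_eq, Equiv.ofBijective_apply, hs]
  map_sink := by rw [Equiv.symm_apply_eq, Equiv.ofBijective_apply, hk]

/-- The subnetwork on the vertices in `A` and the edges in `F`, with new terminals. -/
def restrict (N : Network V E) {A : Set V} {F : Set E}
    (hF : ∀ e ∈ F, N.tail e ∈ A ∧ N.head e ∈ A) (s t : A) : Network A F where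
  tail e := ⟨N.tail e, (hF e e.2).1⟩
  head e := ⟨N.head e, (hF e e.2).2⟩
  source := s
  sink := t

section

variable {A : Set V} {F : Set E} {hF : ∀ e ∈ F, N.tail e ∈ A ∧ N.head e ∈ A} {s t : A}

theorem isWalk_restrict {a b : A} {l : List F} :
    (N.restrict hF s t).IsWalk a l b ↔ N.IsWalk a (l.map Subtype.val) b := by
  induction l generalizing a with
  | nil => exact Subtype.ext_iff
  | cons e l ih =>
    simp only [IsWalk, List.map_cons]
    rw [ih, Subtype.ext_iff]
    rfl

theorem map_verts_restrict (a : A) (l : List F) :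
    ((N.restrict hF s t).verts a l).map Subtype.val = N.verts a (l.map Subtype.val) := by
  simp [verts, restrict, Function.comp_def]

theorem mem_verts_restrict {a x : A} {l : List F} :
    x ∈ (N.restrict hF s t).verts a l ↔ x.1 ∈ N.verts a (l.map Subtype.val) := by
  rw [← map_verts_restrict (hF := hF) (s := s) (t := t),
    List.mem_map_of_injective Subtype.val_injective]

theorem isSTPath_restrict {l : List F} : (N.restrict hF s t).IsSTPath l ↔
    N.IsWalk s (l.map Subtype.val) t ∧ (N.verts s (l.map Subtype.val)).Nodup := by
  rw [IsSTPath, visited_eq, ← List.nodup_map_iff Subtype.val_injective, map_verts_restrict]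
  exact and_congr_left' isWalk_restrict

theorem exists_lift_list {l : List E} (h : ∀ e ∈ l, e ∈ F) :
    ∃ l' : List F, l'.map Subtype.val = l :=
  CanLift.prf l h

end

/-- A network is a parallel composition if its edges split into two classes that only meet at the
terminals. -/
theorem nonempty_iso_parallel {A B : Set V} {F : Set E}
    (hF : ∀ e ∈ F, N.tail e ∈ A ∧ N.head e ∈ A) (hF' : ∀ e ∈ Fᶜ, N.tail e ∈ B ∧ N.head e ∈ B)
    (hAB : ∀ x, x ∈ A ∨ x ∈ B) (hinter : ∀ x ∈ A, x ∈ B → x = N.source ∨ x = N.sink)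
    (hsA : N.source ∈ A) (htA : N.sink ∈ A) (hsB : N.source ∈ B) (htB : N.sink ∈ B) :
    Nonempty (N.Iso ((N.restrict hF ⟨_, hsA⟩ ⟨_, htA⟩).parallel
      (N.restrict hF' ⟨_, hsB⟩ ⟨_, htB⟩))) := by
  classical
  set N₁ := N.restrict hF ⟨_, hsA⟩ ⟨_, htA⟩
  set N₂ := N.restrict hF' ⟨_, hsB⟩ ⟨_, htB⟩
  let f : Quot (ParallelGlue N₁ N₂) → V :=
    Quot.lift (Sum.elim Subtype.val Subtype.val) (by rintro _ _ (_ | _) <;> rfl)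
  have glue : ∀ (x : A) (y : B), x.1 = y.1 →
      Quot.mk (ParallelGlue N₁ N₂) (Sum.inl x) = Quot.mk _ (Sum.inr y) := by
    rintro ⟨x, hx⟩ ⟨y, hy⟩ h
    obtain rfl : x = y := h
    rcases hinter x hx hy with rfl | rfl
    · exact Quot.sound ParallelGlue.source
    · exact Quot.sound ParallelGlue.sink
  have hf : f.Bijective := by
    constructor
    · rintro ⟨x | x⟩ ⟨y | y⟩ h
      · exact congrArg _ (congrArg Sum.inl (Subtype.ext h))
      · exact glue x y h
      · exact (glue y x h.symm).symm
      · exact congrArg _ (congrArg Sum.inr (Subtype.ext h))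
    · intro x
      rcases hAB x with h | h
      · exact ⟨Quot.mk _ (Sum.inl ⟨x, h⟩), rfl⟩
      · exact ⟨Quot.mk _ (Sum.inr ⟨x, h⟩), rfl⟩
  exact ⟨Iso.ofBijective hf (Equiv.Set.sumCompl F) (by rintro (e | e) <;> rfl)
    (by rintro (e | e) <;> rfl) rfl rfl⟩

/-- A network is a series composition if its edges split into two classes that only meet at a
single vertex. -/
theorem nonempty_iso_series {A B : Set V} {F : Set E} {v : V}
    (hF : ∀ e ∈ F, N.tail e ∈ A ∧ N.head e ∈ A) (hF' : ∀ e ∈ Fᶜ, N.tail e ∈ B ∧ N.head e ∈ B)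
    (hAB : ∀ x, x ∈ A ∨ x ∈ B) (hinter : ∀ x ∈ A, x ∈ B → x = v)
    (hsA : N.source ∈ A) (hvA : v ∈ A) (hvB : v ∈ B) (htB : N.sink ∈ B) :
    Nonempty (N.Iso ((N.restrict hF ⟨_, hsA⟩ ⟨_, hvA⟩).series
      (N.restrict hF' ⟨_, hvB⟩ ⟨_, htB⟩))) := by
  classical
  set N₁ := N.restrict hF ⟨_, hsA⟩ ⟨_, hvA⟩
  set N₂ := N.restrict hF' ⟨_, hvB⟩ ⟨_, htB⟩
  let f : Quot (SeriesGlue N₁ N₂) → V :=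
    Quot.lift (Sum.elim Subtype.val Subtype.val) (by rintro _ _ ⟨⟩; rfl)
  have glue : ∀ (x : A) (y : B), x.1 = y.1 →
      Quot.mk (SeriesGlue N₁ N₂) (Sum.inl x) = Quot.mk _ (Sum.inr y) := by
    rintro ⟨x, hx⟩ ⟨y, hy⟩ h
    obtain rfl : x = y := h
    obtain rfl := hinter x hx hy
    exact Quot.sound SeriesGlue.glue
  have hf : f.Bijective := by
    constructor
    · rintro ⟨x | x⟩ ⟨y | y⟩ h
      · exact congrArg _ (congrArg Sum.inl (Subtype.ext h))
      · exact glue x y h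
      · exact (glue y x h.symm).symm
      · exact congrArg _ (congrArg Sum.inr (Subtype.ext h))
    · intro x
      rcases hAB x with h | h
      · exact ⟨Quot.mk _ (Sum.inl ⟨x, h⟩), rfl⟩
      · exact ⟨Quot.mk _ (Sum.inr ⟨x, h⟩), rfl⟩
  exact ⟨Iso.ofBijective hf (Equiv.Set.sumCompl F) (by rintro (e | e) <;> rfl)
    (by rintro (e | e) <;> rfl) rfl rfl⟩

/-- A network all of whose vertices and edges lie on a single path is a simple path. -/
theorem IsSTPath.exists_iso_simplePath {l : List E} (hl : N.IsSTPath l)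
    (hst : N.source ≠ N.sink) (hE : ∀ e, e ∈ l) (hV : ∀ w, w ∈ N.visited l) :
    ∃ k, Nonempty (N.Iso (simplePath k)) := by
  classical
  obtain ⟨k, hk⟩ : ∃ k, l.length = k + 1 :=
    Nat.exists_eq_succ_of_ne_zero fun h => hst (by
      have := hl.1
      rwa [List.length_eq_zero_iff.1 h] at this)
  have hk' : (N.visited l).length = k + 2 := by simp [visited, hk]
  let eV := (finCongr hk').symm.trans (List.Nodup.getEquivOfForallMemList _ hl.2 hV)
  let eE := (finCongr hk).symm.trans
    (List.Nodup.getEquivOfForallMemList _ (nodup_of_nodup_verts hl.2) hE)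
  have hvis : N.visited l = l.map N.tail ++ [N.sink] := hl.1.map_tail_append.symm
  refine ⟨k, ⟨Iso.ofBijective eV.bijective eE (fun e => ?_) (fun e => ?_) ?_ ?_⟩⟩
  · change (N.visited l)[e.val]'(by omega) = N.tail (l[e.val]'(by omega))
    simp only [hvis]
    rw [List.getElem_append_left (by simpa [hk] using e.2), List.getElem_map]
  · change (N.visited l)[e.val + 1]'(by omega) = N.head (l[e.val]'(by omega))
    simp [visited]
  · change (N.visited l)[0]'(by omega) = N.source
    simp [visited]
  · change (N.visited l)[k + 1]'(by omega) = N.sink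
    simp [hvis, hk]

end Restrict

/-! ### Thin networks are series of parallel paths. -/

section Recognition

variable {V : Type u} {E : Type v} {N : Network V E}

/-- Every vertex avoided by some source-sink path has at most one outgoing and at most one
incoming edge. -/
def IsThin (N : Network V E) : Prop :=
  ∀ l, N.IsSTPath l →
    (∀ e e', N.tail e ∉ N.visited l → N.tail e = N.tail e' → e = e') ∧
      ∀ e e', N.head e ∉ N.visited l → N.head e = N.head e' → e = e'

/-- All that the forward direction needs from games; the rest is graph theory. -/
theorem AdmitsSE.isThin (h : N.AdmitsSE) (hE : ∀ e : E, ∃ l : List E, N.IsSTPath l ∧ e ∈ l) :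
    N.IsThin := by
  refine fun Q hQ => ⟨fun e e' hw hee => ?_, fun e e' hw hee => ?_⟩ <;> by_contra hne <;>
    obtain ⟨R, hR, he⟩ := hE e <;> obtain ⟨R', hR', he'⟩ := hE e'
  · obtain ⟨H, a, b, c, d, ho⟩ := exists_isObstruction_of_two_out hne hee hR he hR' he' hQ hw
    exact ho.not_admitsSE h
  · obtain ⟨H, a, b, c, d, ho⟩ := exists_isObstruction_of_two_in hne hee hR he hR' he' hQ hw
    exact ho.not_admitsSE h

theorem IsSTPath.head_ne_source {l : List E} (hl : N.IsSTPath l) {e : E} (he : e ∈ l) :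
    N.head e ≠ N.source := fun h =>
  (List.nodup_cons.1 hl.2).1 (h ▸ List.mem_map_of_mem he)

theorem IsSTPath.tail_ne_sink {l : List E} (hl : N.IsSTPath l) {e : E} (he : e ∈ l) :
    N.tail e ≠ N.sink := by
  have h := hl.2
  rw [visited_eq, ← hl.1.map_tail_append] at h
  exact (List.nodup_append.1 h).2.2 _ (List.mem_map_of_mem he) _ (by simp)

theorem IsSTPath.exists_tail_eq {l : List E} (hl : N.IsSTPath l) {w : V} (hw : w ∈ N.visited l)
    (hk : w ≠ N.sink) : ∃ e ∈ l, N.tail e = w := by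
  rw [visited_eq, ← hl.1.map_tail_append] at hw
  simpa [hk] using hw

theorem exists_head_eq {l : List E} {w a : V} (hw : w ∈ N.verts a l)
    (hs : w ≠ a) : ∃ e ∈ l, N.head e = w := by
  simpa [verts, hs] using hw

/-- If internal vertices have a single outgoing and a single incoming edge, two paths that share
an edge share all of their edges. -/
theorem IsSTPath.mem_iff_mem {l l' : List E} (hl : N.IsSTPath l) (hl' : N.IsSTPath l')
    (hout : ∀ e e', N.tail e ≠ N.source → N.tail e = N.tail e' → e = e')
    (hin : ∀ e e', N.head e ≠ N.sink → N.head e = N.head e' → e = e') {e f : E} (he : e ∈ l')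
    (hf : f ∈ l') : e ∈ l ↔ f ∈ l := by
  -- Consecutive edges of `l'` meet at an internal vertex, where `l` has no choice of how to enter
  -- or leave.
  have step : ∀ e ∈ l', ∀ f ∈ l', N.tail f = N.head e → (e ∈ l ↔ f ∈ l) := by
    intro e he f hf hef
    have hs : N.tail f ≠ N.source := hef ▸ hl'.head_ne_source he
    have ht : N.head e ≠ N.sink := hef ▸ hl'.tail_ne_sink hf
    constructor
    · intro h
      obtain ⟨g, hg, hge⟩ := hl.exists_tail_eq (head_mem_verts h) ht
      rwa [hout f g hs (hef.trans hge.symm)]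
    · intro h
      obtain ⟨g, hg, hge⟩ := exists_head_eq (hl.1.tail_mem_verts h) hs
      rwa [hin e g ht (hef.symm.trans hge.symm)]
  have main : ∀ (a b : V) (m : List E), N.IsWalk a m b → m ⊆ l' →
      ∀ e ∈ m, ∀ f ∈ m, e ∈ l ↔ f ∈ l := by
    intro a b m
    induction m generalizing a with
    | nil => simp
    | cons g m ih =>
      intro hw hm
      have ih' := ih _ hw.2 (fun x hx => hm (List.mem_cons_of_mem _ hx))
      have hg : ∀ x ∈ m, g ∈ l ↔ x ∈ l := by
        cases m with
        | nil => simp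
        | cons k m =>
          intro x hx
          exact (step g (hm (by simp)) k (hm (by simp)) hw.2.1).trans (ih' k (by simp) x hx)
      intro e he f hf
      rcases List.mem_cons.1 he with rfl | he' <;> rcases List.mem_cons.1 hf with rfl | hf'
      · rfl
      · exact hg f hf'
      · exact (hg e he').symm
      · exact ih' e he' f hf'
  exact main _ _ l' hl'.1 (fun _ h => h) e he f hf

theorem IsSTPath.ne_nil {l : List E} (hl : N.IsSTPath l) (hst : N.source ≠ N.sink) : l ≠ [] := by
  rintro rfl
  exact hst hl.1

/-- A network whose internal vertices have a single outgoing and a single incoming edge is a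
parallel composition of paths. -/
theorem isParallelPaths_of_unique_edges {V : Type u} {E : Type v} [Finite E] (N : Network V E)
    (hst : N.source ≠ N.sink) (hE : ∀ e : E, ∃ l : List E, N.IsSTPath l ∧ e ∈ l)
    (hV : ∀ w, w = N.source ∨ ∃ e, N.head e = w)
    (hout : ∀ e e', N.tail e ≠ N.source → N.tail e = N.tail e' → e = e')
    (hin : ∀ e e', N.head e ≠ N.sink → N.head e = N.head e' → e = e') :
    N.IsParallelPaths := by
  induction hn : Nat.card E using Nat.strong_induction_on generalizing V E with
  | _ n ih =>
  obtain ⟨e₀, he₀⟩ := (hV N.sink).resolve_left hst.symm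
  obtain ⟨l, hl, he₀l⟩ := hE e₀
  by_cases hall : ∀ e, e ∈ l
  · obtain ⟨k, ⟨i⟩⟩ := hl.exists_iso_simplePath hst hall fun w => by
      rcases hV w with rfl | ⟨e, rfl⟩
      · exact start_mem_verts _ _
      · exact head_mem_verts (hall e)
    exact IsParallelPaths.path k i
  · push Not at hall
    obtain ⟨e₁, he₁⟩ := hall
    set F : Set E := {e | e ∈ l}
    set A : Set V := {x | x ∈ N.visited l}
    -- The vertices that are not interior to `l`. At an interior vertex of `l` the unique incoming
    -- and outgoing edges belong to `l`, so other edges stay in `B`.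
    set B : Set V := {x | x ∈ N.visited l → x = N.source ∨ x = N.sink}
    have hF : ∀ e ∈ F, N.tail e ∈ A ∧ N.head e ∈ A := fun e he =>
      ⟨hl.1.tail_mem_verts he, head_mem_verts he⟩
    have hF' : ∀ e ∈ Fᶜ, N.tail e ∈ B ∧ N.head e ∈ B := by
      refine fun e he => ⟨fun h => ?_, fun h => ?_⟩ <;> by_contra hne <;> push Not at hne
      · obtain ⟨g, hg, hge⟩ := hl.exists_tail_eq h hne.2
        exact he ((hout e g hne.1 hge.symm).symm ▸ hg)
      · obtain ⟨g, hg, hge⟩ := exists_head_eq h hne.1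
        exact he ((hin e g hne.2 hge.symm).symm ▸ hg)
    have hsA : N.source ∈ A := start_mem_verts _ _
    have htA : N.sink ∈ A := hl.1.end_mem_verts
    have hsB : N.source ∈ B := fun _ => Or.inl rfl
    have htB : N.sink ∈ B := fun _ => Or.inr rfl
    obtain ⟨i⟩ := nonempty_iso_parallel hF hF' (fun x => by
      by_cases h : x ∈ N.visited l
      · exact Or.inl h
      · exact Or.inr fun h' => absurd h' h) (fun x hx hx' => hx' hx) hsA htA hsB htB
    refine IsParallelPaths.parallel ?_ ?_ i
    · obtain ⟨l₁, hl₁⟩ := exists_lift_list (F := F) (l := l) fun e he => he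
      obtain ⟨k, ⟨j⟩⟩ := IsSTPath.exists_iso_simplePath
        (N := N.restrict hF ⟨_, hsA⟩ ⟨_, htA⟩) (isSTPath_restrict.2 (by rwa [hl₁]))
        (fun h => hst (congrArg Subtype.val h))
        (fun e => (List.mem_map_of_injective Subtype.val_injective).1 (by rw [hl₁]; exact e.2))
        (fun w => mem_verts_restrict.2 (by rw [hl₁]; exact w.2))
      exact IsParallelPaths.path k j
    · have hcard : Nat.card (Fᶜ : Set E) < n := by
        rw [← hn]
        exact Finite.card_subtype_lt (x := e₀) (fun h => h he₀l)
      -- A path through an edge off `l` shares no edge with `l`, hence survives when `l` is split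
      -- off.
      have hpath : ∀ e ∉ l, ∃ l', N.IsSTPath l' ∧ e ∈ l' ∧ ∀ f ∈ l', f ∈ Fᶜ := by
        intro e he
        obtain ⟨l', hl', hel'⟩ := hE e
        exact ⟨l', hl', hel', fun f hf h => he ((hl.mem_iff_mem hl' hout hin hel' hf).2 h)⟩
      refine ih _ hcard _ (fun h => hst (congrArg Subtype.val h)) ?_ ?_ ?_ ?_ rfl
      · rintro ⟨e, he⟩
        obtain ⟨l', hl', hel', hF'l'⟩ := hpath e he
        obtain ⟨l₂, rfl⟩ := exists_lift_list hF'l'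
        exact ⟨l₂, isSTPath_restrict.2 hl',
          (List.mem_map_of_injective Subtype.val_injective).1 hel'⟩
      · rintro ⟨w, hw⟩
        by_cases hws : w = N.source
        · exact Or.inl (Subtype.ext hws)
        · refine Or.inr ?_
          suffices ∃ e ∈ Fᶜ, N.head e = w by
            obtain ⟨e, he, hew⟩ := this
            exact ⟨⟨e, he⟩, Subtype.ext hew⟩
          by_cases hwt : w = N.sink
          · subst hwt
            obtain ⟨l', hl', -, hF'l'⟩ := hpath e₁ he₁
            obtain ⟨e, he, hew⟩ := hl'.1.end_mem_heads (hl'.ne_nil hst)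
            exact ⟨e, hF'l' e he, hew⟩
          · obtain ⟨e, rfl⟩ := (hV w).resolve_left hws
            exact ⟨e, fun he => (hw (head_mem_verts he)).elim hws hwt, rfl⟩
      · exact fun e e' hs h => Subtype.ext (hout e e' (fun h' => hs (Subtype.ext h'))
          (congrArg Subtype.val h))
      · exact fun e e' hs h => Subtype.ext (hin e e' (fun h' => hs (Subtype.ext h'))
          (congrArg Subtype.val h))

/-- The vertices that can be reached from the source without passing through `v`. -/
def reachAvoiding (N : Network V E) (v : V) : Set V :=
  {x | ∃ l, N.IsWalk N.source l x ∧ v ∉ N.verts N.source l}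

section Cut

variable {v : V}

theorem notMem_reachAvoiding : v ∉ N.reachAvoiding v := fun ⟨_, h, hv⟩ => hv h.end_mem_verts

theorem source_mem_reachAvoiding (hv : v ≠ N.source) : N.source ∈ N.reachAvoiding v :=
  ⟨[], rfl, by simpa [verts] using hv⟩

theorem head_mem_reachAvoiding {e : E} (he : N.tail e ∈ N.reachAvoiding v) (hv : N.head e ≠ v) :
    N.head e ∈ N.reachAvoiding v := by
  obtain ⟨l, hl, h⟩ := he
  refine ⟨l ++ [e], hl.append ⟨rfl, rfl⟩, ?_⟩
  simp [verts_append, h, hv.symm]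

theorem sink_notMem_reachAvoiding (hcut : ∀ l, N.IsSTPath l → v ∈ N.visited l) :
    N.sink ∉ N.reachAvoiding v := by
  rintro ⟨l, hl, h⟩
  obtain ⟨l', hsub, hl', hn⟩ := hl.exists_simple
  have hvl' := hcut l' ⟨hl', hn⟩
  have hsv : v ≠ N.source := fun h' => h (h' ▸ start_mem_verts _ _)
  obtain ⟨e, he, rfl⟩ := exists_head_eq hvl' hsv
  exact h (head_mem_verts (hsub he))

theorem tail_mem_of_prefix {l₁ : List E} (h₁ : N.IsWalk N.source l₁ v)
    (hn : (N.verts N.source l₁).Nodup) {e : E} (he : e ∈ l₁) :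
    N.tail e ∈ N.reachAvoiding v := by
  obtain ⟨p, q, rfl⟩ := List.append_of_mem he
  obtain ⟨c, hp, hq⟩ := isWalk_append.1 h₁
  obtain rfl : N.tail e = c := hq.1
  obtain ⟨f, hf, rfl⟩ := hq.end_mem_heads (by simp)
  exact ⟨p, hp, head_notMem_of_nodup hn hf⟩

/-- Otherwise a walk that reaches the head of `e` without meeting `v`, continued along the rest of
`l₂`, would reach the sink without meeting `v`. -/
theorem head_notMem_of_suffix (hcut : ∀ l, N.IsSTPath l → v ∈ N.visited l) {l₂ : List E}
    (h₂ : N.IsWalk v l₂ N.sink) (hn : (N.verts v l₂).Nodup) {e : E} (he : e ∈ l₂) :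
    N.head e ∉ N.reachAvoiding v := by
  rintro ⟨m, hm, hv⟩
  obtain ⟨p, q, rfl⟩ := List.append_of_mem he
  obtain ⟨c, hp, hq⟩ := isWalk_append.1 h₂
  refine sink_notMem_reachAvoiding hcut ⟨m ++ q, hm.append hq.2, ?_⟩
  rw [verts_append, List.mem_append, not_or]
  refine ⟨hv, fun h => ?_⟩
  obtain ⟨f, hf, hfv⟩ := List.mem_map.1 h
  exact (List.nodup_cons.1 hn).1 (hfv ▸ List.mem_map_of_mem (by simp [hf]))

theorem tail_notMem_of_suffix (hcut : ∀ l, N.IsSTPath l → v ∈ N.visited l) {l₂ : List E}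
    (h₂ : N.IsWalk v l₂ N.sink) (hn : (N.verts v l₂).Nodup) {e : E} (he : e ∈ l₂) :
    N.tail e ∉ N.reachAvoiding v := by
  intro h
  have hv := notMem_reachAvoiding (N := N) (v := v)
  obtain ⟨f, hf, hfe⟩ := exists_head_eq (h₂.tail_mem_verts he) (fun h' => hv (h' ▸ h))
  exact head_notMem_of_suffix hcut h₂ hn hf (hfe ▸ h)

end Cut

/-- A walk that ends at `v` and one that starts at `v` form a path if they are simple and live on
different sides of `v`. -/
theorem isSTPath_append {v : V} {C : Set V} {l₁ l₂ : List E} (h₁ : N.IsWalk N.source l₁ v)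
    (hn₁ : (N.verts N.source l₁).Nodup) (h₂ : N.IsWalk v l₂ N.sink) (hn₂ : (N.verts v l₂).Nodup)
    (hC₁ : ∀ x ∈ N.verts N.source l₁, x = v ∨ x ∈ C) (hC₂ : ∀ e ∈ l₂, N.head e ∉ C) :
    N.IsSTPath (l₁ ++ l₂) := by
  refine ⟨h₁.append h₂, ?_⟩
  rw [visited_eq, verts_append]
  obtain ⟨hv, hn₂⟩ := List.nodup_cons.1 hn₂
  refine List.nodup_append.2 ⟨hn₁, hn₂, fun x hx y hy hxy => ?_⟩
  subst hxy
  rcases hC₁ x hx with rfl | hxC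
  · exact hv hy
  · obtain ⟨e, he, rfl⟩ := List.mem_map.1 hy
    exact hC₂ e he hxC

/-- A thin network is a series of parallel paths. -/
theorem IsThin.isSPP {V : Type u} {E : Type v} [Finite E] {N : Network V E}
    (hthin : N.IsThin) (hst : N.source ≠ N.sink)
    (hE : ∀ e : E, ∃ l : List E, N.IsSTPath l ∧ e ∈ l)
    (hV : ∀ w, w = N.source ∨ ∃ e, N.head e = w) : N.IsSPP := by
  induction hn : Nat.card E using Nat.strong_induction_on generalizing V E with
  | _ n ih =>
  have hnosink : ∀ e, N.tail e ≠ N.sink := fun e => by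
    obtain ⟨l, hl, he⟩ := hE e
    exact hl.tail_ne_sink he
  have hnosource : ∀ e, N.head e ≠ N.source := fun e => by
    obtain ⟨l, hl, he⟩ := hE e
    exact hl.head_ne_source he
  by_cases hcut : ∀ w, w ≠ N.source → w ≠ N.sink → ∃ l, N.IsSTPath l ∧ w ∉ N.visited l
  · refine IsSPP.block (isParallelPaths_of_unique_edges N hst hE hV ?_ ?_)
    · intro e e' hs h
      obtain ⟨l, hl, hw⟩ := hcut _ hs (hnosink e)
      exact (hthin l hl).1 e e' hw h
    · intro e e' hk h
      obtain ⟨l, hl, hw⟩ := hcut _ (hnosource e) hk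
      exact (hthin l hl).2 e e' hw h
  · push Not at hcut
    obtain ⟨v₀, hv₀s, hv₀t, hv₀⟩ := hcut
    obtain ⟨e₀, -⟩ := (hV N.sink).resolve_left hst.symm
    obtain ⟨l₀, hl₀, -⟩ := hE e₀
    set X : Set V := {x | x ≠ N.source ∧ x ≠ N.sink ∧ ∀ l, N.IsSTPath l → x ∈ N.visited l}
    -- The last internal cut vertex `v` on `l₀` is chosen so that the part after it has no internal
    -- cut vertex and is a single block.
    obtain ⟨p, e, q, rfl, hp, ⟨hvs, hvt, hcut⟩, hq, hlast⟩ := hl₀.1.last_exit X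
      ⟨v₀, hv₀ _ hl₀, hv₀s, hv₀t, hv₀⟩ (fun h => h.2.1 rfl)
    set v := N.tail e
    have hq : N.IsWalk v (e :: q) N.sink := ⟨rfl, hq⟩
    set C := N.reachAvoiding v
    have hvC : v ∉ C := notMem_reachAvoiding
    have hsC : N.source ∈ C := source_mem_reachAvoiding hvs
    have htC : N.sink ∉ C := sink_notMem_reachAvoiding hcut
    -- Every path splits at `v` into a part with edges in `F` and a part with edges outside `F`.
    set F : Set E := {f | N.tail f ∈ C}
    have prefF : ∀ {l}, N.IsWalk N.source l v → (N.verts N.source l).Nodup → ∀ f ∈ l, f ∈ F :=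
      fun h hn f hf => tail_mem_of_prefix h hn hf
    have sufF : ∀ {l}, N.IsWalk v l N.sink → (N.verts v l).Nodup → ∀ f ∈ l, f ∈ Fᶜ :=
      fun h hn f hf => tail_notMem_of_suffix hcut h hn hf
    have sufC : ∀ {l}, N.IsWalk v l N.sink → (N.verts v l).Nodup → ∀ f ∈ l, N.head f ∉ C :=
      fun h hn f hf => head_notMem_of_suffix hcut h hn hf
    have decomp : ∀ l, N.IsSTPath l → ∃ l₁ l₂, l = l₁ ++ l₂ ∧ N.IsWalk N.source l₁ v ∧
        (N.verts N.source l₁).Nodup ∧ N.IsWalk v l₂ N.sink ∧ (N.verts v l₂).Nodup := by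
      intro l hl
      obtain ⟨l₁, l₂, rfl, h₁, h₂⟩ := hl.1.split (hcut l hl)
      exact ⟨l₁, l₂, rfl, h₁, nodup_left hl.2, h₂, h₁.nodup_right hl.2⟩
    have hF : ∀ f ∈ F, N.tail f ∈ insert v C ∧ N.head f ∈ insert v C := by
      refine fun f hf => ⟨Or.inr hf, ?_⟩
      by_cases h : N.head f = v
      · exact Or.inl h
      · exact Or.inr (head_mem_reachAvoiding hf h)
    have hF' : ∀ f ∈ Fᶜ, N.tail f ∈ Cᶜ ∧ N.head f ∈ Cᶜ := by
      refine fun f hf => ⟨hf, ?_⟩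
      obtain ⟨l, hl, hfl⟩ := hE f
      obtain ⟨l₁, l₂, rfl, h₁, hn₁, h₂, hn₂⟩ := decomp l hl
      rcases List.mem_append.1 hfl with h | h
      · exact absurd (prefF h₁ hn₁ f h) hf
      · exact sufC h₂ hn₂ f h
    have hsA : N.source ∈ insert v C := Or.inr hsC
    have hvA : v ∈ insert v C := Or.inl rfl
    have preC : ∀ l : List F, ∀ x ∈ N.verts N.source (l.map Subtype.val), x = v ∨ x ∈ C := by
      intro l x hx
      rcases List.mem_cons.1 hx with rfl | hx
      · exact hsA
      · simp only [List.map_map, List.mem_map] at hx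
        obtain ⟨f, -, rfl⟩ := hx
        exact (hF f f.2).2
    obtain ⟨i⟩ := nonempty_iso_series hF hF' (fun x => by
      by_cases h : x ∈ C
      · exact Or.inl (Or.inr h)
      · exact Or.inr h) (fun x hx hx' => hx.resolve_right hx') hsA hvA hvC htC
    have hnp := nodup_left hl₀.2
    have hnq := hp.nodup_right hl₀.2
    refine IsSPP.series ?_ ?_ i
    · have hcard : Nat.card F < n := by
        rw [← hn]
        exact Finite.card_subtype_lt (x := e) (fun h => hvC h)
      refine ih _ hcard ?_ (fun h => hvs (congrArg Subtype.val h).symm) ?_ ?_ rfl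
      · intro m hm
        rw [isSTPath_restrict] at hm
        -- Thinness is inherited: a path of the first part extends by `e :: q` to a path of `N`,
        -- which avoids the same vertices of the first part.
        have hpath := isSTPath_append hm.1 hm.2 hq hnq (preC m) (sufC hq hnq)
        have key : ∀ w : (insert v C : Set V), w ∉ (N.restrict hF ⟨_, hsA⟩ ⟨_, hvA⟩).visited m →
            w.1 ∉ N.visited (m.map Subtype.val ++ e :: q) := by
          intro w hw h
          rw [visited_eq, verts_append, List.mem_append] at h
          rw [visited_eq, mem_verts_restrict] at hw
          rcases h with h | h
          · exact hw h
          · obtain ⟨f, hf, hfw⟩ := List.mem_map.1 h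
            rcases w.2 with hwv | hwC
            · rw [hwv] at hw
              exact hw hm.1.end_mem_verts
            · exact sufC hq hnq f hf (hfw ▸ hwC)
        exact ⟨fun f f' hw h => Subtype.ext
            ((hthin _ hpath).1 f f' (key _ hw) (congrArg Subtype.val h)),
          fun f f' hw h => Subtype.ext
            ((hthin _ hpath).2 f f' (key _ hw) (congrArg Subtype.val h))⟩
      · rintro ⟨f, hf⟩
        obtain ⟨l, hl, hfl⟩ := hE f
        obtain ⟨l₁, l₂, rfl, h₁, hn₁, h₂, hn₂⟩ := decomp l hl
        have hfl₁ : f ∈ l₁ := (List.mem_append.1 hfl).resolve_right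
          fun h => sufF h₂ hn₂ f h hf
        obtain ⟨m, rfl⟩ := exists_lift_list (prefF h₁ hn₁)
        exact ⟨m, isSTPath_restrict.2 ⟨h₁, hn₁⟩,
          (List.mem_map_of_injective Subtype.val_injective).1 hfl₁⟩
      · rintro ⟨w, hw⟩
        by_cases hws : w = N.source
        · exact Or.inl (Subtype.ext hws)
        · refine Or.inr ?_
          suffices ∃ f ∈ F, N.head f = w by
            obtain ⟨f, hf, hfw⟩ := this
            exact ⟨⟨f, hf⟩, Subtype.ext hfw⟩
          by_cases hwv : w = v
          · obtain ⟨f, hf, hfv⟩ := hp.end_mem_heads (by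
              rintro rfl
              exact hvs (show N.source = v from hp).symm)
            exact ⟨f, prefF hp hnp f hf, hfv.trans hwv.symm⟩
          · obtain ⟨f, rfl⟩ := (hV w).resolve_left hws
            refine ⟨f, ?_, rfl⟩
            by_contra hf
            exact (hF' f hf).2 (hw.resolve_left hwv)
    · have hE₂ : ∀ f, ∃ l, (N.restrict hF' ⟨v, hvC⟩ ⟨_, htC⟩).IsSTPath l ∧ f ∈ l := by
        rintro ⟨f, hf⟩
        obtain ⟨l, hl, hfl⟩ := hE f
        obtain ⟨l₁, l₂, rfl, h₁, hn₁, h₂, hn₂⟩ := decomp l hl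
        have hfl₂ : f ∈ l₂ := (List.mem_append.1 hfl).resolve_left
          fun h => hf (prefF h₁ hn₁ f h)
        obtain ⟨m, rfl⟩ := exists_lift_list (sufF h₂ hn₂)
        exact ⟨m, isSTPath_restrict.2 ⟨h₂, hn₂⟩,
          (List.mem_map_of_injective Subtype.val_injective).1 hfl₂⟩
      -- an internal vertex of the last block is avoided by some path
      have avoid : ∀ w ∉ C, w ≠ v → w ≠ N.sink → ∃ l, N.IsSTPath l ∧ w ∉ N.visited l := by
        intro w hwC hwv hwt
        by_contra hall
        push Not at hall
        have hwX : w ∈ X := ⟨fun h => hwC (h ▸ hsC), hwt, hall⟩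
        have hw := hall _ hl₀
        rw [visited_eq, verts_append, List.mem_append] at hw
        rcases hw with hw | hw
        · obtain ⟨m, rfl⟩ := exists_lift_list (prefF hp hnp)
          rcases preC m w hw with h | h
          · exact hwv h
          · exact hwC h
        · obtain ⟨f, hf, rfl⟩ := List.mem_map.1 hw
          exact hlast f hf hwX
      refine isParallelPaths_of_unique_edges _ (fun h => hvt (congrArg Subtype.val h)) hE₂ ?_ ?_ ?_
      · rintro ⟨w, hw⟩
        by_cases hwv : w = v
        · exact Or.inl (Subtype.ext hwv)
        · obtain ⟨f, rfl⟩ := (hV w).resolve_left fun h => hw (h ▸ hsC)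
          refine Or.inr ⟨⟨f, fun hf => ?_⟩, rfl⟩
          exact hw (head_mem_reachAvoiding hf hwv)
      · intro f f' hs h
        obtain ⟨l, hl, hw⟩ := avoid (N.tail f) (hF' f f.2).1 (fun h => hs (Subtype.ext h))
          (hnosink f)
        exact Subtype.ext ((hthin l hl).1 f f' hw (congrArg Subtype.val h))
      · intro f f' hk h
        have hfv : N.head f ≠ v := by
          obtain ⟨l, hl, hfl⟩ := hE₂ f
          exact fun h => hl.head_ne_source hfl (Subtype.ext h)
        obtain ⟨l, hl, hw⟩ := avoid (N.head f) (hF' f f.2).2 hfv (fun h => hk (Subtype.ext h))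
        exact Subtype.ext ((hthin l hl).2 f f' hw (congrArg Subtype.val h))

end Recognition

/-! ### Greedy assignment to parallel links. -/

section Greedy

open Classical in
/-- Agents who share links with capacities can be assigned to the links in such a way that no
agent can lower her share while the agents before her keep their links. -/
theorem exists_greedy_assignment {S : Type*} [Fintype S] (price : S → ℝ≥0) (n : ℕ) (cap : S → ℕ)
    (hn : n ≤ ∑ s, cap s) :
    ∃ σ : Fin n → S, (∀ s, (Finset.univ.filter fun i => σ i = s).card ≤ cap s) ∧
      ∀ τ : Fin n → S, (∀ s, (Finset.univ.filter fun i => τ i = s).card ≤ cap s) →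
        ∀ j, (∀ i < j, τ i = σ i) →
          price (σ j) / ((Finset.univ.filter fun i => σ i = σ j).card : ℝ≥0) ≤
            price (τ j) / ((Finset.univ.filter fun i => τ i = τ j).card : ℝ≥0) := by
  induction n using Nat.strong_induction_on generalizing cap with
  | _ n ih =>
  rcases Nat.eq_zero_or_pos n with rfl | hpos
  · exact ⟨Fin.elim0, fun s => by simp, fun τ _ j => j.elim0⟩
  obtain ⟨s₁, -, hs₁⟩ : ∃ s ∈ Finset.univ, cap s ≠ 0 :=
    Finset.exists_ne_zero_of_sum_ne_zero (by omega)
  -- At most `min (cap s) n` agents fit on `s`, so the minimised quotient is the lowest share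
  -- attainable anywhere. The first `m` agents fill `s₀`.
  obtain ⟨s₀, hs₀, hmin⟩ := Finset.exists_min_image (Finset.univ.filter fun s => cap s ≠ 0)
    (fun s => price s / ((min (cap s) n : ℕ) : ℝ≥0)) ⟨s₁, by simpa using hs₁⟩
  simp only [Finset.mem_filter, Finset.mem_univ, true_and] at hs₀ hmin
  obtain ⟨m, hm⟩ : ∃ m, m = min (cap s₀) n := ⟨_, rfl⟩
  rw [← hm] at hmin
  obtain ⟨r, rfl⟩ : ∃ r, n = m + r := ⟨n - m, by omega⟩
  have hmcap : m ≤ cap s₀ := by omega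
  have hm0 : 0 < m := by omega
  set cap' : S → ℕ := fun s => cap s - if s = s₀ then m else 0 with hcap'
  have hadd : ∀ s, cap s = cap' s + if s = s₀ then m else 0 := fun s => by
    simp only [hcap']
    split_ifs with h
    · subst h; omega
    · simp
  have hr : r ≤ ∑ s, cap' s := by
    have : ∑ s, cap s = ∑ s, cap' s + m := by
      rw [Finset.sum_congr rfl fun s _ => hadd s, Finset.sum_add_distrib]
      simp
    omega
  -- Either every agent is placed or `s₀` is full; so no later agent joins `s₀` and disturbs the
  -- loads.
  have hzero : r = 0 ∨ cap' s₀ = 0 := by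
    simp only [hcap', if_true]
    omega
  obtain ⟨σ, hσ, hord⟩ := ih r (by omega) cap' hr
  have hcard : ∀ (ρ : Fin (m + r) → S) (s : S), (Finset.univ.filter fun i => ρ i = s).card =
      (Finset.univ.filter fun i : Fin m => ρ (Fin.castAdd r i) = s).card +
        (Finset.univ.filter fun i : Fin r => ρ (Fin.natAdd m i) = s).card := fun ρ s => by
    simp only [Finset.card_filter, Fin.sum_univ_add]
  have hcardm : ∀ (ρ : Fin (m + r) → S), (∀ i, ρ (Fin.castAdd r i) = s₀) → ∀ s,
      (Finset.univ.filter fun i => ρ i = s).card = (if s = s₀ then m else 0) +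
        (Finset.univ.filter fun i : Fin r => ρ (Fin.natAdd m i) = s).card := by
    intro ρ hρ s
    rw [hcard]
    congr 1
    simp only [hρ]
    split_ifs with h
    · simp [h]
    · simp [Ne.symm h]
  have hne : ∀ ρ : Fin r → S, (∀ s, (Finset.univ.filter fun i => ρ i = s).card ≤ cap' s) →
      ∀ i, ρ i ≠ s₀ := by
    intro ρ hρ i hi
    have h := hρ s₀
    have : 0 < (Finset.univ.filter fun i => ρ i = s₀).card :=
      Finset.card_pos.2 ⟨i, by simpa using hi⟩
    have := i.pos
    omega
  have hr0 : ∀ ρ : Fin r → S, (∀ s, (Finset.univ.filter fun i => ρ i = s).card ≤ cap' s) →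
      (Finset.univ.filter fun i => ρ i = s₀).card = 0 := by
    intro ρ hρ
    simpa using hne ρ hρ
  set σ' : Fin (m + r) → S := Fin.append (fun _ => s₀) σ
  have hl : ∀ i, σ' (Fin.castAdd r i) = s₀ := fun i => Fin.append_left _ _ i
  have hr' : ∀ i, σ' (Fin.natAdd m i) = σ i := fun i => Fin.append_right _ _ i
  refine ⟨σ', fun s => ?_, fun τ hτ j => ?_⟩
  · rw [hcardm σ' hl, hadd s]
    simp only [hr']
    have := hσ s
    omega
  · refine Fin.addCases (fun j => ?_) (fun j => ?_) j
    · intro _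
      rw [hl, hcardm σ' hl]
      simp only [hr', if_true]
      rw [hr0 σ hσ, add_zero]
      have h₁ : 0 < (Finset.univ.filter fun i => τ i = τ (Fin.castAdd r j)).card :=
        Finset.card_pos.2 ⟨Fin.castAdd r j, by simp⟩
      have h₂ := hτ (τ (Fin.castAdd r j))
      have h₃ : (Finset.univ.filter fun i => τ i = τ (Fin.castAdd r j)).card ≤ m + r :=
        (Finset.card_le_univ _).trans (Fintype.card_fin _).le
      -- For the agents on `s₀` the bound holds whatever the others do.
      refine (hmin (τ (Fin.castAdd r j)) (by omega)).trans ?_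
      refine div_le_div_of_nonneg_left (zero_le) (by exact_mod_cast h₁) ?_
      exact_mod_cast le_min h₂ h₃
    · intro hj
      -- A later agent faces unmoved agents on `s₀`, so `τ` restricts to a deviation in the residual
      -- problem.
      have hτl : ∀ i, τ (Fin.castAdd r i) = s₀ := fun i => by
        rw [hj _ (by rw [Fin.lt_def, Fin.val_castAdd, Fin.val_natAdd]; omega), hl]
      have hτ' : ∀ s, (Finset.univ.filter fun i => τ (Fin.natAdd m i) = s).card ≤ cap' s := by
        intro s
        have := hτ s
        rw [hcardm τ hτl, hadd s] at this
        omega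
      have := hord (fun i => τ (Fin.natAdd m i)) hτ' j fun i hi => by
        rw [hj _ (by
          rw [Fin.lt_def] at hi ⊢
          simpa using hi), hr']
      rw [hr', hcardm σ' hl, hcardm τ hτl, if_neg (hne σ hσ j), if_neg (hne _ hτ' j), zero_add,
        zero_add]
      simpa only [hr'] using this

end Greedy

/-! ### Ordered profiles. -/

section Ordered

variable {V : Type u} {E : Type v} {N : Network V E}

/-- Every feasible game on `N` has a feasible profile in which no agent can lower her cost while
the agents before her keep their strategies. -/
def IsOrdered (N : Network V E) : Prop :=
  ∀ Δ : CCSGame N, Δ.Feasible → ∃ σ : Δ.Profile, Δ.IsFeasible σ ∧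
    ∀ τ, Δ.IsFeasible τ → ∀ j, (∀ i < j, τ i = σ i) → Δ.share σ j ≤ Δ.share τ j

/-- All agents before the least member of a coalition stay put, so she cannot gain. -/
theorem IsOrdered.admitsSE (h : N.IsOrdered) : N.AdmitsSE := by
  intro Δ hΔ
  obtain ⟨σ, hσ, hord⟩ := h Δ hΔ
  refine ⟨σ, fun C hC τ hτ => ⟨C.min' hC, C.min'_mem hC, ?_⟩⟩
  by_cases hf : Δ.IsFeasible τ
  · rw [CCSGame.agentCost_of_isFeasible hσ, CCSGame.agentCost_of_isFeasible hf,
      ENNReal.coe_le_coe]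
    exact hord τ hf _ fun i hi => hτ i fun hiC => (C.min'_le i hiC).not_gt hi
  · rw [CCSGame.agentCost_of_not_isFeasible hf]
    exact le_top

/-- A network in which every edge lies on exactly one path behaves like parallel links. -/
theorem isOrdered_of_existsUnique [Finite E] (hst : N.source ≠ N.sink)
    (h : ∀ e, ∃! l, N.IsSTPath l ∧ e ∈ l) : N.IsOrdered := by
  classical
  choose path hpath huniq using h
  have hmem : ∀ (s : N.Strategy) (e : E), e ∈ s.1 ↔ s = ⟨path e, (hpath e).1⟩ := by
    refine fun s e => ⟨fun he => Subtype.ext (huniq e s.1 ⟨s.2, he⟩), ?_⟩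
    rintro rfl
    exact (hpath e).2
  have : Finite N.Strategy :=
    Finite.of_surjective (fun e => (⟨path e, (hpath e).1⟩ : N.Strategy)) fun s => by
      obtain ⟨e, he⟩ := List.exists_mem_of_ne_nil _ (s.2.ne_nil hst)
      exact ⟨e, ((hmem s e).1 he).symm⟩
  have := Fintype.ofFinite N.Strategy
  rintro Δ ⟨σ₀, hσ₀⟩
  -- A path acts as one link whose capacity is that of its bottleneck and whose price is the sum of
  -- its costs.
  have hcap : ∀ s : N.Strategy, ∃ c, ∀ k, k ≤ c ↔ ∀ e ∈ s.1, k ≤ Δ.capacity e := fun s =>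
    ⟨s.1.toFinset.inf' (by simpa using s.2.ne_nil hst) Δ.capacity, fun k => by simp⟩
  choose cap hcap using hcap
  have hload : ∀ (σ : Δ.Profile) (s : N.Strategy) (e : E), e ∈ s.1 →
      Δ.load σ e = (Finset.univ.filter fun i => σ i = s).card := by
    intro σ s e he
    unfold CCSGame.load
    congr 1
    refine Finset.filter_congr fun i _ => ?_
    rw [hmem, (hmem s e).1 he]
  have hfeas : ∀ σ : Δ.Profile, Δ.IsFeasible σ ↔
      ∀ s, (Finset.univ.filter fun i => σ i = s).card ≤ cap s := by
    intro σ
    constructor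
    · intro h s
      rw [hcap]
      intro e he
      rw [← hload σ s e he]
      exact h e
    · intro h e
      rw [hload σ ⟨path e, (hpath e).1⟩ e (hpath e).2]
      exact (hcap _ _).1 (h _) e (hpath e).2
  have hshare : ∀ (σ : Δ.Profile) i, Δ.share σ i =
      ((σ i).1.map Δ.cost).sum / ((Finset.univ.filter fun k => σ k = σ i).card : ℝ≥0) := by
    intro σ i
    unfold CCSGame.share
    rw [List.map_congr_left (g := fun e =>
        Δ.cost e * ((Finset.univ.filter fun k => σ k = σ i).card : ℝ≥0)⁻¹) fun e he => by
      rw [hload σ (σ i) e he, div_eq_mul_inv], List.sum_map_mul_right, div_eq_mul_inv]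
  -- The given feasible profile shows that the links have room for all agents.
  have hn : Δ.agents ≤ ∑ s, cap s := by
    calc Δ.agents = (Finset.univ : Finset (Fin Δ.agents)).card := by simp
      _ = ∑ s, (Finset.univ.filter fun i => σ₀ i = s).card :=
        Finset.card_eq_sum_card_fiberwise fun i _ => Finset.mem_coe.2 (Finset.mem_univ _)
      _ ≤ ∑ s, cap s := Finset.sum_le_sum fun s _ => (hfeas σ₀).1 hσ₀ s
  obtain ⟨σ, hσ, hord⟩ := exists_greedy_assignment (fun s : N.Strategy => (s.1.map Δ.cost).sum)
    Δ.agents cap hn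
  refine ⟨σ, (hfeas σ).2 hσ, fun τ hτ j hj => ?_⟩
  rw [hshare, hshare]
  exact hord τ ((hfeas τ).1 hτ) j hj

/-- If the paths of `N` are the concatenations of the paths of two networks, agents can be ordered
on `N` as soon as they can on both parts. -/
theorem IsOrdered.of_concat {V₁ : Type*} {V₂ : Type*} {E₁ : Type*} {E₂ : Type*}
    {N₁ : Network V₁ E₁} {N₂ : Network V₂ E₂}
    (h₁ : N₁.IsOrdered) (h₂ : N₂.IsOrdered) (g : E ≃ E₁ ⊕ E₂)
    (hsplit : ∀ l, N.IsSTPath l ↔ ∃ l₁ l₂, N₁.IsSTPath l₁ ∧ N₂.IsSTPath l₂ ∧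
      l.map g = l₁.map Sum.inl ++ l₂.map Sum.inr) : N.IsOrdered := by
  classical
  have hproj : ∀ s : N.Strategy, ∃ (s₁ : N₁.Strategy) (s₂ : N₂.Strategy),
      s.1.map g = s₁.1.map Sum.inl ++ s₂.1.map Sum.inr := by
    rintro ⟨l, hl⟩
    obtain ⟨l₁, l₂, hl₁, hl₂, h⟩ := (hsplit l).1 hl
    exact ⟨⟨l₁, hl₁⟩, ⟨l₂, hl₂⟩, h⟩
  choose f₁ f₂ hf using hproj
  have hjoin : ∀ (s₁ : N₁.Strategy) (s₂ : N₂.Strategy), ∃ s : N.Strategy,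
      f₁ s = s₁ ∧ f₂ s = s₂ := by
    intro s₁ s₂
    have hmap : ((s₁.1.map Sum.inl ++ s₂.1.map Sum.inr).map g.symm).map g =
        s₁.1.map Sum.inl ++ s₂.1.map Sum.inr := by
      rw [List.map_map, Equiv.self_comp_symm, List.map_id]
    let s : N.Strategy := ⟨(s₁.1.map Sum.inl ++ s₂.1.map Sum.inr).map g.symm,
      (hsplit _).2 ⟨s₁.1, s₂.1, s₁.2, s₂.2, hmap⟩⟩
    have h := (hf s).symm.trans hmap
    refine ⟨s, Subtype.ext ?_, Subtype.ext ?_⟩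
    · simpa [List.filterMap_append, List.filterMap_map, Function.comp_def] using
        congrArg (List.filterMap Sum.getLeft?) h
    · simpa [List.filterMap_append, List.filterMap_map, Function.comp_def] using
        congrArg (List.filterMap Sum.getRight?) h
  choose join hj₁ hj₂ using hjoin
  have hmem : ∀ (s : N.Strategy) x, g.symm x ∈ s.1 ↔ x ∈ s.1.map g := fun s x => by
    rw [List.mem_map]
    refine ⟨fun h => ⟨_, h, g.apply_symm_apply x⟩, ?_⟩
    rintro ⟨e, he, rfl⟩
    rwa [g.symm_apply_apply]
  have hmem₁ : ∀ (s : N.Strategy) e, g.symm (Sum.inl e) ∈ s.1 ↔ e ∈ (f₁ s).1 := fun s e => by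
    rw [hmem, hf]
    simp
  have hmem₂ : ∀ (s : N.Strategy) e, g.symm (Sum.inr e) ∈ s.1 ↔ e ∈ (f₂ s).1 := fun s e => by
    rw [hmem, hf]
    simp
  intro Δ hΔ
  let Δ₁ : CCSGame N₁ := ⟨Δ.agents, fun e => Δ.cost (g.symm (Sum.inl e)),
    fun e => Δ.capacity (g.symm (Sum.inl e))⟩
  let Δ₂ : CCSGame N₂ := ⟨Δ.agents, fun e => Δ.cost (g.symm (Sum.inr e)),
    fun e => Δ.capacity (g.symm (Sum.inr e))⟩
  have hload₁ : ∀ (σ : Δ.Profile) e,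
      Δ.load σ (g.symm (Sum.inl e)) = Δ₁.load (fun i => f₁ (σ i)) e := fun σ e => by
    unfold CCSGame.load
    congr 1
    exact Finset.filter_congr fun i _ => hmem₁ _ e
  have hload₂ : ∀ (σ : Δ.Profile) e,
      Δ.load σ (g.symm (Sum.inr e)) = Δ₂.load (fun i => f₂ (σ i)) e := fun σ e => by
    unfold CCSGame.load
    congr 1
    exact Finset.filter_congr fun i _ => hmem₂ _ e
  have hfeas : ∀ σ : Δ.Profile, Δ.IsFeasible σ ↔
      Δ₁.IsFeasible (fun i => f₁ (σ i)) ∧ Δ₂.IsFeasible (fun i => f₂ (σ i)) := by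
    intro σ
    constructor
    · intro h
      exact ⟨fun e => (hload₁ σ e).symm.trans_le (h _), fun e => (hload₂ σ e).symm.trans_le (h _)⟩
    · rintro ⟨k₁, k₂⟩ e
      obtain ⟨e | e, rfl⟩ := g.symm.surjective e
      · exact (hload₁ σ e).trans_le (k₁ e)
      · exact (hload₂ σ e).trans_le (k₂ e)
  have hshare : ∀ (σ : Δ.Profile) i, Δ.share σ i =
      Δ₁.share (fun i => f₁ (σ i)) i + Δ₂.share (fun i => f₂ (σ i)) i := by
    intro σ i
    have : (σ i).1 = ((f₁ (σ i)).1.map Sum.inl ++ (f₂ (σ i)).1.map Sum.inr).map g.symm := by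
      rw [← hf]
      simp
    unfold CCSGame.share
    rw [this]
    simp only [List.map_append, List.map_map, List.sum_append, Function.comp_def, hload₁, hload₂]
    rfl
  obtain ⟨σ₀, hσ₀⟩ := hΔ
  obtain ⟨k₁, k₂⟩ := (hfeas σ₀).1 hσ₀
  obtain ⟨σ₁, hσ₁, hord₁⟩ := h₁ Δ₁ ⟨_, k₁⟩
  obtain ⟨σ₂, hσ₂, hord₂⟩ := h₂ Δ₂ ⟨_, k₂⟩
  -- Agent `i` has the same rank in both parts, so a deviation that fixes earlier agents does so in
  -- each part.
  let σ : Δ.Profile := fun i => join (σ₁ i) (σ₂ i)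
  have hp₁ : (fun i => f₁ (σ i)) = σ₁ := funext fun i => hj₁ _ _
  have hp₂ : (fun i => f₂ (σ i)) = σ₂ := funext fun i => hj₂ _ _
  refine ⟨σ, (hfeas σ).2 (by rw [hp₁, hp₂]; exact ⟨hσ₁, hσ₂⟩), fun τ hτ j hj => ?_⟩
  rw [hshare, hshare, hp₁, hp₂]
  obtain ⟨t₁, t₂⟩ := (hfeas τ).1 hτ
  exact add_le_add
    (hord₁ _ t₁ j fun i hi => by simp only [hj i hi]; exact hj₁ _ _)
    (hord₂ _ t₂ j fun i hi => by simp only [hj i hi]; exact hj₂ _ _)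

end Ordered

/-! ### Transport along embeddings, and paths of `simplePath`. -/

section Embedding

variable {V : Type u} {E : Type v} {V' : Type u'} {E' : Type v'} {N : Network V E}
  {N' : Network V' E'}

/-- Walks are preserved and reflected by injective maps of networks. -/
theorem isWalk_map_iff {φ : V → V'} {ε : E → E'} (hφ : φ.Injective)
    (ht : ∀ e, N'.tail (ε e) = φ (N.tail e)) (hh : ∀ e, N'.head (ε e) = φ (N.head e)) {a b : V}
    {l : List E} : N'.IsWalk (φ a) (l.map ε) (φ b) ↔ N.IsWalk a l b := by
  induction l generalizing a with
  | nil => exact hφ.eq_iff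
  | cons e l ih =>
    simp only [IsWalk, List.map_cons]
    rw [ht, hh, ih, hφ.eq_iff]

theorem verts_map {φ : V → V'} {ε : E → E'} (hh : ∀ e, N'.head (ε e) = φ (N.head e)) (a : V)
    (l : List E) : N'.verts (φ a) (l.map ε) = (N.verts a l).map φ := by
  simp [verts, hh, Function.comp_def]

theorem Iso.isSTPath_map_iff (i : N.Iso N') {l : List E} :
    N'.IsSTPath (l.map i.edgeEquiv) ↔ N.IsSTPath l := by
  rw [IsSTPath, IsSTPath, visited_eq, visited_eq, ← i.map_source, ← i.map_sink,
    verts_map (fun e => (i.map_head e).symm), List.nodup_map_iff i.vertexEquiv.injective,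
    isWalk_map_iff i.vertexEquiv.injective (fun e => (i.map_tail e).symm)
      (fun e => (i.map_head e).symm)]

theorem Iso.existsUnique_path (i : N.Iso N') (h : ∀ e, ∃! l, N'.IsSTPath l ∧ e ∈ l) (e : E) :
    ∃! l, N.IsSTPath l ∧ e ∈ l := by
  obtain ⟨l, ⟨hl, he⟩, hu⟩ := h (i.edgeEquiv e)
  have hback : (l.map i.edgeEquiv.symm).map i.edgeEquiv = l := by
    rw [List.map_map, Equiv.self_comp_symm, List.map_id]
  refine ⟨l.map i.edgeEquiv.symm, ⟨i.isSTPath_map_iff.1 (by rwa [hback]),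
    List.mem_map.2 ⟨_, he, by simp⟩⟩, ?_⟩
  rintro m ⟨hm, hem⟩
  rw [← hu (m.map i.edgeEquiv) ⟨i.isSTPath_map_iff.2 hm, List.mem_map_of_mem hem⟩, List.map_map,
    Equiv.symm_comp_self, List.map_id]

end Embedding

section SimplePath

variable {k : ℕ}

/-- Edge `i` leads from vertex `i` to vertex `i + 1`, so a walk is a run of consecutive numbers. -/
theorem IsWalk.simplePath_eq {a b : Fin (k + 2)} {l : List (Fin (k + 1))}
    (h : (simplePath k).IsWalk a l b) :
    b.val = a.val + l.length ∧ l.map Fin.val = List.range' a.val l.length := by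
  induction l generalizing a with
  | nil =>
    obtain rfl : a = b := h
    simp
  | cons e l ih =>
    obtain ⟨h₁, h₂⟩ := ih h.2
    have ha : e.val = a.val := congrArg Fin.val (show e.castSucc = a from h.1)
    have hs : ((simplePath k).head e).val = e.val + 1 := rfl
    rw [hs] at h₁ h₂
    refine ⟨by simp; omega, ?_⟩
    rw [List.map_cons, List.length_cons, List.range'_succ, h₂, ha]

theorem exists_isWalk_simplePath (n : ℕ) (a : Fin (k + 2)) (h : a.val + n = k + 1) :
    ∃ l, (simplePath k).IsWalk a l (Fin.last (k + 1)) := by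
  induction n generalizing a with
  | zero => exact ⟨[], Fin.ext (by simpa using h)⟩
  | succ n ih =>
    obtain ⟨l, hl⟩ := ih (Fin.succ ⟨a.val, by omega⟩) (by simp; omega)
    exact ⟨⟨a.val, by omega⟩ :: l, rfl, hl⟩

theorem existsUnique_path_simplePath (e : Fin (k + 1)) :
    ∃! l, (simplePath k).IsSTPath l ∧ e ∈ l := by
  have hwalk : ∀ l, (simplePath k).IsWalk (simplePath k).source l (simplePath k).sink →
      l.map Fin.val = List.range (k + 1) := by
    intro l hl
    obtain ⟨h₁, h₂⟩ := hl.simplePath_eq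
    have hl : k + 1 = l.length := by simpa [simplePath] using h₁
    rw [h₂, ← hl, List.range_eq_range']
    rfl
  obtain ⟨l, hl⟩ := exists_isWalk_simplePath (k + 1) (0 : Fin (k + 2)) (by simp)
  obtain ⟨l', -, hl', hn⟩ := hl.exists_simple
  refine ⟨l', ⟨⟨hl', hn⟩, ?_⟩, ?_⟩
  · have : e.val ∈ l'.map Fin.val := by
      rw [hwalk l' hl']
      exact List.mem_range.2 e.2
    exact (List.mem_map_of_injective Fin.val_injective).1 this
  · rintro m ⟨hm, -⟩
    exact List.map_injective_iff.2 Fin.val_injective ((hwalk m hm.1).trans (hwalk l' hl').symm)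

end SimplePath

/-! ### Paths of a parallel composition. -/

section Parallel

variable {V₁ V₂ : Type u} {E₁ E₂ : Type v} {N₁ : Network V₁ E₁} {N₂ : Network V₂ E₂}

/-- The predicate `P` describes the class of `x` and descends to the quotient, so its truth carries
over from `x` to `z`. If the terminals of `N₂` coincided, the gluing would also merge those of `N₁`.
-/
theorem parallel_inl_eq (h₂ : N₂.source ≠ N₂.sink) {x : V₁} {z : V₁ ⊕ V₂}
    (h : Quot.mk (ParallelGlue N₁ N₂) (Sum.inl x) = Quot.mk _ z) :
    Sum.elim (fun y => y = x)
      (fun y => y = N₂.source ∧ x = N₁.source ∨ y = N₂.sink ∧ x = N₁.sink) z := by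
  let P : V₁ ⊕ V₂ → Prop := Sum.elim (fun y => y = x)
      (fun y => y = N₂.source ∧ x = N₁.source ∨ y = N₂.sink ∧ x = N₁.sink)
  have hP : ∀ a b, ParallelGlue N₁ N₂ a b → P a = P b := by
    rintro _ _ (_ | _) <;> simp [P, h₂, h₂.symm, eq_comm]
  exact (show (x = x) = P z from congrArg (Quot.lift P hP) h).mp rfl

theorem parallel_inr_eq (h₁ : N₁.source ≠ N₁.sink) {x : V₂} {z : V₁ ⊕ V₂}
    (h : Quot.mk (ParallelGlue N₁ N₂) (Sum.inr x) = Quot.mk _ z) :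
    Sum.elim (fun y => y = N₁.source ∧ x = N₂.source ∨ y = N₁.sink ∧ x = N₂.sink)
      (fun y => y = x) z := by
  let P : V₁ ⊕ V₂ → Prop := Sum.elim
      (fun y => y = N₁.source ∧ x = N₂.source ∨ y = N₁.sink ∧ x = N₂.sink) (fun y => y = x)
  have hP : ∀ a b, ParallelGlue N₁ N₂ a b → P a = P b := by
    rintro _ _ (_ | _) <;> simp [P, h₁, h₁.symm, eq_comm]
  exact (show (x = x) = P z from congrArg (Quot.lift P hP) h).mp rfl

/-- A path that starts inside one of the branches of a network stays inside it: no other edges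
start at the internal vertices of the branch. -/
theorem IsWalk.exists_eq_map {V : Type u} {E : Type v} {V' : Type u'} {E' : Type v'}
    {N : Network V E} {N' : Network V' E'} {φ : V → V'} {ε : E → E'}
    (hh : ∀ e, N'.head (ε e) = φ (N.head e)) (hs : φ N.source = N'.source) (hk : φ N.sink = N'.sink)
    (hbranch : ∀ e x, N'.tail e = φ x → x ≠ N.source → x ≠ N.sink → ∃ f, e = ε f)
    {l : List E'} {a : V} (hl : N'.IsWalk (φ a) l N'.sink) (hn : (N'.verts (φ a) l).Nodup)
    (hsl : N'.source ∉ N'.verts (φ a) l) : ∃ m : List E, l = m.map ε := by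
  induction l generalizing a with
  | nil => exact ⟨[], rfl⟩
  | cons e l ih =>
    have ha : a ≠ N.source := by
      rintro rfl
      exact hsl (hs ▸ start_mem_verts _ _)
    have ha' : a ≠ N.sink := by
      rintro rfl
      obtain ⟨f, hf, hfk⟩ := hl.end_mem_heads (by simp)
      exact (List.nodup_cons.1 hn).1 (List.mem_map.2 ⟨f, hf, hfk.trans hk.symm⟩)
    obtain ⟨f, rfl⟩ := hbranch e a hl.1 ha ha'
    rw [verts_cons, hh] at hn hsl
    obtain ⟨m, rfl⟩ := ih (hh f ▸ hl.2) (List.nodup_cons.1 hn).2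
      (fun h => hsl (List.mem_cons_of_mem _ h))
    exact ⟨f :: m, rfl⟩

theorem parallel_isSTPath_inl (h₂ : N₂.source ≠ N₂.sink) {l : List E₁} :
    (N₁.parallel N₂).IsSTPath (l.map Sum.inl) ↔ N₁.IsSTPath l := by
  have hφ : Function.Injective fun x => Quot.mk (ParallelGlue N₁ N₂) (Sum.inl x) :=
    fun x y h => (parallel_inl_eq h₂ h).symm
  rw [IsSTPath, IsSTPath, visited_eq, visited_eq]
  refine and_congr (isWalk_map_iff hφ (fun _ => rfl) (fun _ => rfl)) ?_
  rw [← List.nodup_map_iff hφ]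
  exact iff_of_eq (congrArg _ (verts_map (N := N₁) (N' := N₁.parallel N₂)
    (φ := fun x => Quot.mk (ParallelGlue N₁ N₂) (Sum.inl x)) (ε := Sum.inl)
      (fun _ => rfl) N₁.source l))

theorem parallel_source : (N₁.parallel N₂).source = Quot.mk _ (Sum.inr N₂.source) :=
  Quot.sound ParallelGlue.source

theorem parallel_sink : (N₁.parallel N₂).sink = Quot.mk _ (Sum.inr N₂.sink) :=
  Quot.sound ParallelGlue.sink

theorem parallel_isSTPath_inr (h₁ : N₁.source ≠ N₁.sink) {l : List E₂} :
    (N₁.parallel N₂).IsSTPath (l.map Sum.inr) ↔ N₂.IsSTPath l := by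
  have hφ : Function.Injective fun x => Quot.mk (ParallelGlue N₁ N₂) (Sum.inr x) :=
    fun x y h => (parallel_inr_eq h₁ h).symm
  rw [IsSTPath, IsSTPath, visited_eq, visited_eq, parallel_source, parallel_sink]
  refine and_congr (isWalk_map_iff hφ (fun _ => rfl) (fun _ => rfl)) ?_
  rw [← List.nodup_map_iff hφ]
  exact iff_of_eq (congrArg _ (verts_map (N := N₂) (N' := N₁.parallel N₂)
    (φ := fun x => Quot.mk (ParallelGlue N₁ N₂) (Sum.inr x)) (ε := Sum.inr)
      (fun _ => rfl) N₂.source l))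

theorem parallel_source_ne_sink (h₁ : N₁.source ≠ N₁.sink) (h₂ : N₂.source ≠ N₂.sink) :
    (N₁.parallel N₂).source ≠ (N₁.parallel N₂).sink :=
  fun h => h₁ (parallel_inl_eq h₂ h).symm

/-- The paths of a parallel composition are the paths of the two components. -/
theorem IsSTPath.parallel_cases (h₁ : N₁.source ≠ N₁.sink) (h₂ : N₂.source ≠ N₂.sink)
    {l : List (E₁ ⊕ E₂)} (hl : (N₁.parallel N₂).IsSTPath l) :
    (∃ m : List E₁, l = m.map Sum.inl) ∨ ∃ m : List E₂, l = m.map Sum.inr := by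
  obtain ⟨hw, hn⟩ := hl
  rw [visited_eq] at hn
  cases l with
  | nil => exact absurd hw (parallel_source_ne_sink h₁ h₂)
  | cons e l =>
    rw [verts_cons, List.nodup_cons] at hn
    rcases e with e | e
    · obtain ⟨m, rfl⟩ := IsWalk.exists_eq_map (N := N₁) (N' := N₁.parallel N₂)
        (φ := fun x => Quot.mk (ParallelGlue N₁ N₂) (Sum.inl x)) (ε := Sum.inl)
        (fun _ => rfl) rfl rfl
        (by
          rintro (f | f) x hf hxs hxt
          · exact ⟨f, rfl⟩
          · rcases parallel_inr_eq h₁ (z := Sum.inl x) hf with h | h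
            · exact absurd h.1 hxs
            · exact absurd h.1 hxt)
        hw.2 hn.2 hn.1
      exact Or.inl ⟨e :: m, rfl⟩
    · obtain ⟨m, rfl⟩ := IsWalk.exists_eq_map (N := N₂) (N' := N₁.parallel N₂)
        (φ := fun x => Quot.mk (ParallelGlue N₁ N₂) (Sum.inr x)) (ε := Sum.inr)
        (fun _ => rfl) parallel_source.symm parallel_sink.symm
        (by
          rintro (f | f) x hf hxs hxt
          · rcases parallel_inl_eq h₂ (z := Sum.inr x) hf with h | h
            · exact absurd h.1 hxs
            · exact absurd h.1 hxt
          · exact ⟨f, rfl⟩)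
        hw.2 hn.2 hn.1
      exact Or.inr ⟨e :: m, rfl⟩

/-- In a parallel composition of paths every edge lies on exactly one path. -/
theorem IsParallelPaths.existsUnique_path {V : Type u} {E : Type v} {N : Network V E}
    (h : N.IsParallelPaths) : N.source ≠ N.sink ∧ ∀ e, ∃! l, N.IsSTPath l ∧ e ∈ l := by
  induction h with
  | path k i =>
    refine ⟨fun h => ?_, i.existsUnique_path existsUnique_path_simplePath⟩
    have := congrArg i.vertexEquiv h
    rw [i.map_source, i.map_sink] at this
    simp [simplePath, Fin.ext_iff] at this
  | @parallel V V₁ V₂ E E₁ E₂ N N₁ N₂ _ _ i ih₁ ih₂ =>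
    obtain ⟨h₁, hu₁⟩ := ih₁
    obtain ⟨h₂, hu₂⟩ := ih₂
    refine ⟨fun h => parallel_source_ne_sink h₁ h₂ ?_, i.existsUnique_path ?_⟩
    · rw [← i.map_source, ← i.map_sink, h]
    · rintro (e | e)
      · obtain ⟨l, ⟨hl, he⟩, hu⟩ := hu₁ e
        refine ⟨l.map Sum.inl, ⟨(parallel_isSTPath_inl h₂).2 hl, List.mem_map_of_mem he⟩, ?_⟩
        rintro m ⟨hm, hem⟩
        rcases hm.parallel_cases h₁ h₂ with ⟨m, rfl⟩ | ⟨m, rfl⟩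
        · rw [hu m ⟨(parallel_isSTPath_inl h₂).1 hm, by simpa using hem⟩]
        · simp at hem
      · obtain ⟨l, ⟨hl, he⟩, hu⟩ := hu₂ e
        refine ⟨l.map Sum.inr, ⟨(parallel_isSTPath_inr h₁).2 hl, List.mem_map_of_mem he⟩, ?_⟩
        rintro m ⟨hm, hem⟩
        rcases hm.parallel_cases h₁ h₂ with ⟨m, rfl⟩ | ⟨m, rfl⟩
        · simp at hem
        · rw [hu m ⟨(parallel_isSTPath_inr h₁).1 hm, by simpa using hem⟩]

end Parallel

/-! ### Paths of a series composition, and the converse direction. -/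

section Series

variable {V₁ V₂ : Type u} {E₁ E₂ : Type v} {N₁ : Network V₁ E₁} {N₂ : Network V₂ E₂}

theorem series_inl_eq {x : V₁} {z : V₁ ⊕ V₂}
    (h : Quot.mk (SeriesGlue N₁ N₂) (Sum.inl x) = Quot.mk _ z) :
    Sum.elim (fun y => y = x) (fun y => y = N₂.source ∧ x = N₁.sink) z := by
  let P : V₁ ⊕ V₂ → Prop :=
    Sum.elim (fun y => y = x) (fun y => y = N₂.source ∧ x = N₁.sink)
  have hP : ∀ a b, SeriesGlue N₁ N₂ a b → P a = P b := by
    rintro _ _ ⟨⟩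
    simp [P, eq_comm]
  exact (show (x = x) = P z from congrArg (Quot.lift P hP) h).mp rfl

theorem series_inr_injective :
    Function.Injective fun x => Quot.mk (SeriesGlue N₁ N₂) (Sum.inr x) := by
  intro x y h
  -- Only one vertex of `N₁` is glued, so a constant value on `V₁` is enough for `P` to descend.
  let P : V₁ ⊕ V₂ → Prop := Sum.elim (fun _ => x = N₂.source) (fun y => y = x)
  have hP : ∀ a b, SeriesGlue N₁ N₂ a b → P a = P b := by
    rintro _ _ ⟨⟩
    simp [P, eq_comm]
  exact ((show (x = x) = (y = x) from congrArg (Quot.lift P hP) h).mp rfl).symm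

theorem series_inl_injective :
    Function.Injective fun x => Quot.mk (SeriesGlue N₁ N₂) (Sum.inl x) :=
  fun _ _ h => (series_inl_eq h).symm

/-- An edge of `N₁` can leave a vertex of `N₂` only at the glued vertex, which the walk avoids. -/
theorem IsWalk.series_inr {c d : V₂} {l : List (E₁ ⊕ E₂)}
    (h : (N₁.series N₂).IsWalk (Quot.mk _ (Sum.inr c)) l (Quot.mk _ (Sum.inr d)))
    (hs : Quot.mk _ (Sum.inr N₂.source) ∉ (N₁.series N₂).verts (Quot.mk _ (Sum.inr c)) l) :
    ∃ m : List E₂, l = m.map Sum.inr := by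
  induction l generalizing c with
  | nil => exact ⟨[], rfl⟩
  | cons e l ih =>
    rcases e with e | e
    · refine absurd ?_ hs
      rw [← (series_inl_eq (z := Sum.inr c) h.1).1]
      exact start_mem_verts _ _
    · rw [verts_cons, List.mem_cons, not_or] at hs
      obtain ⟨m, rfl⟩ := ih h.2 hs.2
      exact ⟨e :: m, rfl⟩

/-- Sides change only at the glued vertex, which a simple walk visits once. -/
theorem IsWalk.series_inl {a : V₁} {d : V₂} {l : List (E₁ ⊕ E₂)}
    (h : (N₁.series N₂).IsWalk (Quot.mk _ (Sum.inl a)) l (Quot.mk _ (Sum.inr d)))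
    (hn : ((N₁.series N₂).verts (Quot.mk _ (Sum.inl a)) l).Nodup) :
    ∃ (l₁ : List E₁) (l₂ : List E₂), l = l₁.map Sum.inl ++ l₂.map Sum.inr ∧
      N₁.IsWalk a l₁ N₁.sink := by
  induction l generalizing a with
  | nil => exact ⟨[], [], rfl, (series_inl_eq (z := Sum.inr d) h).2⟩
  | cons e l ih =>
    rw [verts_cons, List.nodup_cons] at hn
    rcases e with e | e
    · obtain rfl := series_inl_injective h.1
      obtain ⟨l₁, l₂, rfl, hl₁⟩ := ih h.2 hn.2
      exact ⟨e :: l₁, l₂, rfl, rfl, hl₁⟩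
    · obtain ⟨hes, rfl⟩ := series_inl_eq (z := Sum.inr (N₂.tail e)) h.1.symm
      have hglue : Quot.mk (SeriesGlue N₁ N₂) (Sum.inl N₁.sink) = Quot.mk _ (Sum.inr N₂.source) :=
        Quot.sound SeriesGlue.glue
      rw [hglue] at hn
      obtain ⟨m, rfl⟩ := IsWalk.series_inr h.2 hn.1
      exact ⟨[], e :: m, rfl, rfl⟩

theorem isSTPath_series_append {l₁ : List E₁} {l₂ : List E₂} (h₁ : N₁.IsWalk N₁.source l₁ N₁.sink) :
    (N₁.series N₂).IsSTPath (l₁.map Sum.inl ++ l₂.map Sum.inr) ↔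
      N₁.IsSTPath l₁ ∧ N₂.IsSTPath l₂ := by
  have hglue : Quot.mk (SeriesGlue N₁ N₂) (Sum.inl N₁.sink) = Quot.mk _ (Sum.inr N₂.source) :=
    Quot.sound SeriesGlue.glue
  have hw₁ : (N₁.series N₂).IsWalk (N₁.series N₂).source (l₁.map Sum.inl)
      (Quot.mk _ (Sum.inr N₂.source)) := by
    rw [← hglue]
    exact (isWalk_map_iff (N := N₁) (N' := N₁.series N₂)
      (φ := fun x => Quot.mk (SeriesGlue N₁ N₂) (Sum.inl x)) (ε := Sum.inl)
      series_inl_injective (fun _ => rfl) (fun _ => rfl)).2 h₁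
  have hw₂ : (N₁.series N₂).IsWalk (Quot.mk _ (Sum.inr N₂.source)) (l₂.map Sum.inr)
      (N₁.series N₂).sink ↔ N₂.IsWalk N₂.source l₂ N₂.sink :=
    isWalk_map_iff (N := N₂) (N' := N₁.series N₂)
      (φ := fun x => Quot.mk (SeriesGlue N₁ N₂) (Sum.inr x)) (ε := Sum.inr)
      series_inr_injective (fun _ => rfl) (fun _ => rfl)
  have hv₁ : (N₁.series N₂).verts (N₁.series N₂).source (l₁.map Sum.inl) =
      (N₁.verts N₁.source l₁).map fun x => Quot.mk (SeriesGlue N₁ N₂) (Sum.inl x) :=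
    verts_map (N := N₁) (N' := N₁.series N₂)
      (φ := fun x => Quot.mk (SeriesGlue N₁ N₂) (Sum.inl x)) (fun _ => rfl) _ _
  have hv₂ : (N₁.series N₂).verts (Quot.mk _ (Sum.inr N₂.source)) (l₂.map Sum.inr) =
      (N₂.verts N₂.source l₂).map fun x => Quot.mk (SeriesGlue N₁ N₂) (Sum.inr x) :=
    verts_map (N := N₂) (N' := N₁.series N₂)
      (φ := fun x => Quot.mk (SeriesGlue N₁ N₂) (Sum.inr x)) (fun _ => rfl) _ _
  have hn₁ : ((N₁.series N₂).verts (N₁.series N₂).source (l₁.map Sum.inl)).Nodup ↔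
      (N₁.verts N₁.source l₁).Nodup := by
    rw [hv₁, List.nodup_map_iff series_inl_injective]
  have hn₂ : ((N₁.series N₂).verts (Quot.mk _ (Sum.inr N₂.source)) (l₂.map Sum.inr)).Nodup ↔
      (N₂.verts N₂.source l₂).Nodup := by
    rw [hv₂, List.nodup_map_iff series_inr_injective]
  constructor
  · rintro ⟨hw, hn⟩
    rw [visited_eq] at hn
    obtain ⟨c, hc₁, hc₂⟩ := isWalk_append.1 hw
    obtain rfl := hw₁.end_unique hc₁
    exact ⟨⟨h₁, hn₁.1 (nodup_left hn)⟩, hw₂.1 hc₂, hn₂.1 (hw₁.nodup_right hn)⟩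
  · rintro ⟨hl₁, hl₂⟩
    refine ⟨hw₁.append (hw₂.2 hl₂.1), ?_⟩
    rw [visited_eq, verts_append]
    refine List.nodup_append.2 ⟨hn₁.2 hl₁.2, (List.nodup_cons.1 (hn₂.2 hl₂.2)).2, ?_⟩
    rintro x hx y hy rfl
    rw [hv₁] at hx
    obtain ⟨x, -, rfl⟩ := List.mem_map.1 hx
    obtain ⟨f, hf, hfx⟩ := List.mem_map.1 hy
    obtain ⟨e, he, rfl⟩ := List.mem_map.1 hf
    -- A vertex common to both halves is the glued one, and no edge of the path `l₂` enters the
    -- source of `N₂`.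
    exact hl₂.head_ne_source he (series_inl_eq (z := Sum.inr (N₂.head e)) hfx.symm).1

theorem IsOrdered.series {V : Type u} {E : Type v} {N : Network V E} (h₁ : N₁.IsOrdered)
    (h₂ : N₂.IsOrdered) (i : N.Iso (N₁.series N₂)) : N.IsOrdered := by
  refine h₁.of_concat h₂ i.edgeEquiv fun l => ?_
  rw [← i.isSTPath_map_iff]
  constructor
  · intro hl
    obtain ⟨l₁, l₂, h, hw⟩ := IsWalk.series_inl hl.1 hl.2
    rw [h, isSTPath_series_append hw] at hl
    exact ⟨l₁, l₂, hl.1, hl.2, h⟩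
  · rintro ⟨l₁, l₂, hl₁, hl₂, h⟩
    rw [h, isSTPath_series_append hl₁.1]
    exact ⟨hl₁, hl₂⟩

theorem IsSPP.isOrdered {V : Type u} {E : Type v} {N : Network V E} (h : N.IsSPP)
    (hE : Finite E) : N.IsOrdered := by
  induction h with
  | block h =>
    obtain ⟨hst, hu⟩ := h.existsUnique_path
    exact isOrdered_of_existsUnique hst hu
  | @series V V₁ V₂ E E₁ E₂ N N₁ N₂ _ h₂ i ih =>
    have := Finite.of_equiv E i.edgeEquiv
    have : Finite E₂ := Finite.sum_right E₁
    obtain ⟨hst, hu⟩ := h₂.existsUnique_path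
    exact (ih (Finite.sum_left E₂)).series (isOrdered_of_existsUnique hst hu) i

end Series

end Network

theorem theorem1 {V : Type u} {E : Type v} [Finite V] [Finite E] (N : Network V E)
    (hst : N.source ≠ N.sink)
    (hV : ∀ w : V, ∃ l : List E, N.IsSTPath l ∧ w ∈ N.visited l)
    (hE : ∀ e : E, ∃ l : List E, N.IsSTPath l ∧ e ∈ l) :
    N.AdmitsSE ↔ N.IsSPP := by
  refine ⟨fun h => (h.isThin hE).isSPP hst hE fun w => ?_,
    fun h => (h.isOrdered ‹Finite E›).admitsSE⟩
  -- Recognition uses the vertex hypothesis in a local form, which its inductions re-establish for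
  -- subnetworks.
  obtain ⟨l, -, hw⟩ := hV w
  by_cases hws : w = N.source
  · exact Or.inl hws
  · obtain ⟨e, -, he⟩ := Network.exists_head_eq hw hws
    exact Or.inr ⟨e, he⟩
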